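/- Let $0\le q\in L_1^{\rm loc}(\mathbb R)$ satisfy $\int_{-\infty}^x q(t)\,dt>0$ and $\int_x^\infty q(t)\,dt>0$ for all $x\in\mathbb R$ (infinite values allowed), and let $\mu,\theta:\mathbb R\to(0,\infty)$ be continuous. For each $x\in\mathbb R$ let $d(x)>0$ be the unique solution $d\ge 0$ of $$\int_0^{\sqrt2\,d}\int_{x-t}^{x+t}q(\xi)\,d\xi\,dt=2 .$$ For a positive continuous weight $w$ and $p\in[1,\infty)$ let $L_{p,w}$ be the space of $f\in L_p^{\rm loc}(\mathbb R)$ with $\|f\|_{p,w}=\left(\int_{-\infty}^\infty|w(x)f(x)|^p\,dx\right)^{1/p}<\infty$. A solution of $$-y''(x)+q(x)y(x)=f(x),\qquad x\in\mathbb R, \tag{1}$$ is a function $y$ that is (locally) absolutely continuous together with its derivative $y'$ and satisfies (1) almost everywhere. The pair $\{L_{p,\mu},L_{p,\theta}\}$ is called admissible for (1) if for every $f\in L_{p,\theta}$ there is a unique solution $y\in L_{p,\mu}$ of (1), and there is a constant $c(p)\in(0,\infty)$ such that $\|y\|_{p,\mu}\le c(p)\|f\|_{p,\theta}$ for every $f\in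 L_{p,\theta}$ and the corresponding solution $y\in L_{p,\mu}$. Assume that: (a) $\int_{-\infty}^0\mu(t)\,dt=\int_0^\infty\mu(t)\,dt=\infty$; (b) $q\in H$, that is, $\nu(x)\to0$ as $|x|\to\infty$, where $\nu(x)=d(x)\int_0^{\sqrt2\,d(x)}\bigl(q(x+t)-q(x-t)\bigr)dt$; (c) the pair $\{\mu,\theta\}$ agrees with $q$, that is, for every $\varepsilon>0$ there is a constant $c(\varepsilon)\in[1,\infty)$ such that for all $t,x\in\mathbb R$ each of the two quantities $$\sqrt{\frac{d(t)}{d(x)}}\,\frac{\mu(t)}{\mu(x)},\qquad \sqrt{\frac{d(t)}{d(x)}}\,\frac{\theta(x)}{\theta(t)}$$ lies between $c(\varepsilon)^{-1}\exp\left(-\varepsilon\left|\int_x^t\frac{d\xi}{d(\xi)}\right|\right)$ and $c(\varepsilon)\exp\left(\varepsilon\left|\int_x^t\frac{d\xi}{d(\xi)}\right|\right)$. Then for each $p\in[1,\infty)$ the pair $\{L_{p,\mu},L_{p,\theta}\}$ is admissible for (1) if and only if $$m(q,\mu,\theta)=\sup_{x\in\mathbb R}\left(\frac{\mu(x)}{\theta(x)}\,d(x)^2\right)<\infty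 .$$ -/

import Mathlib

open MeasureTheory Filter Set
open scoped ENNReal Topology

namespace SturmLiouville

/-- `f ∈ L_p^loc(ℝ)`. -/
def MemLpLoc (f : ℝ → ℝ) (p : ℝ≥0∞) : Prop :=
  AEStronglyMeasurable f volume ∧ ∀ K : Set ℝ, IsCompact K → MemLp f p (volume.restrict K)

/-- The weighted norm `(∫ |w f|^p)^(1/p)`, with value `∞` allowed. -/
noncomputable def weightedNorm (w : ℝ → ℝ) (p : ℝ≥0∞) (f : ℝ → ℝ) : ℝ≥0∞ :=
  eLpNorm (fun x => w x * f x) p volume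

/-- `f ∈ L_p(ℝ, w)`. -/
def MemWeightedLp (w : ℝ → ℝ) (p : ℝ≥0∞) (f : ℝ → ℝ) : Prop :=
  MemLpLoc f p ∧ weightedNorm w p f < ∞

/-- Absolute continuity on every compact interval. -/
def LocallyAC (g : ℝ → ℝ) : Prop :=
  ∀ a b : ℝ, AbsolutelyContinuousOnInterval g a b

/-- `y` is a solution of `-y'' + q y = f` on `ℝ`: `y` is differentiable, `y` and `y'` are locally
absolutely continuous, and the equation holds almost everywhere. -/
def IsSolution (q f y : ℝ → ℝ) : Prop :=
  Differentiable ℝ y ∧ LocallyAC y ∧ LocallyAC (deriv y) ∧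
    ∀ᵐ x : ℝ, -deriv (deriv y) x + q x * y x = f x

/-- The pair `{L_{p,μ}, L_{p,θ}}` is admissible for `-y'' + q y = f`. -/
def IsAdmissible (q μ θ : ℝ → ℝ) (p : ℝ≥0∞) : Prop :=
  (∀ f : ℝ → ℝ, MemWeightedLp θ p f → ∃! y : ℝ → ℝ, IsSolution q f y ∧ MemWeightedLp μ p y) ∧
  ∃ c : ℝ, 0 < c ∧ ∀ f y : ℝ → ℝ, MemWeightedLp θ p f → IsSolution q f y → MemWeightedLp μ p y →
    weightedNorm μ p y ≤ ENNReal.ofReal c * weightedNorm θ p f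

/-- `∫_{-∞}^x q > 0` and `∫_x^∞ q > 0` for all `x` (for `q ≥ 0`; the integrals may be infinite). -/
def PositiveTails (q : ℝ → ℝ) : Prop :=
  ∀ x : ℝ, 0 < ∫⁻ t in Iic x, ENNReal.ofReal (q t) ∧ 0 < ∫⁻ t in Ici x, ENNReal.ofReal (q t)

/-- `∫_{-∞}^0 w = ∫_0^∞ w = ∞` (for `w ≥ 0`). -/
def DivergentTails (w : ℝ → ℝ) : Prop :=
  ∫⁻ t in Iic (0 : ℝ), ENNReal.ofReal (w t) = ∞ ∧ ∫⁻ t in Ici (0 : ℝ), ENNReal.ofReal (w t) = ∞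

/-- `F_x(η) = ∫_0^{√2 η} ∫_{x-t}^{x+t} q(ξ) dξ dt`. -/
noncomputable def averagingIntegral (q : ℝ → ℝ) (x η : ℝ) : ℝ :=
  ∫ t in (0 : ℝ)..(√2 * η), ∫ ξ in (x - t)..(x + t), q ξ

/-- `d(x)`, the solution `η ≥ 0` of `F_x(η) = 2`; it exists and is unique by
`existsUnique_averagingRadius` below, so the infimum is that of a one-point set. -/
noncomputable def averagingRadius (q : ℝ → ℝ) (x : ℝ) : ℝ :=
  sInf {η : ℝ | 0 ≤ η ∧ averagingIntegral q x η = 2}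

/-- `ν(x) = d(x) ∫_0^{√2 d(x)} (q(x+t) - q(x-t)) dt`. -/
noncomputable def nu (q : ℝ → ℝ) (x : ℝ) : ℝ :=
  averagingRadius q x * ∫ t in (0 : ℝ)..(√2 * averagingRadius q x), (q (x + t) - q (x - t))

/-- `q ∈ H`: `ν(x) → 0` as `|x| → ∞`. -/
def ClassH (q : ℝ → ℝ) : Prop :=
  Tendsto (nu q) (cocompact ℝ) (𝓝 0)

/-- `|∫_x^t dξ / d(ξ)|`. -/
noncomputable def averagingDist (q : ℝ → ℝ) (x t : ℝ) : ℝ :=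
  |∫ ξ in x..t, 1 / averagingRadius q ξ|

/-- The pair of weights `{μ, θ}` agrees with `q`. -/
def Agrees (q μ θ : ℝ → ℝ) : Prop :=
  ∀ ε : ℝ, 0 < ε → ∃ c : ℝ, 1 ≤ c ∧ ∀ t x : ℝ,
    √(averagingRadius q t / averagingRadius q x) * (μ t / μ x) ∈
      Icc (c⁻¹ * Real.exp (-ε * averagingDist q x t)) (c * Real.exp (ε * averagingDist q x t)) ∧
    √(averagingRadius q t / averagingRadius q x) * (θ x / θ t) ∈
      Icc (c⁻¹ * Real.exp (-ε * averagingDist q x t)) (c * Real.exp (ε * averagingDist q x t))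

/-- `m(q, μ, θ) = sup_x μ(x) d(x)² / θ(x)`, as an element of `[0, ∞]`. -/
noncomputable def weightSup (q μ θ : ℝ → ℝ) : ℝ≥0∞ :=
  ⨆ x : ℝ, ENNReal.ofReal (μ x / θ x * averagingRadius q x ^ 2)

/-- `F_x(η) = 2` has exactly one solution `η ≥ 0`. -/
theorem existsUnique_averagingRadius (q : ℝ → ℝ) (hq : LocallyIntegrable q volume)
    (hq0 : ∀ᵐ x : ℝ, 0 ≤ q x) (hpos : PositiveTails q) (x : ℝ) :
    ∃! η : ℝ, 0 ≤ η ∧ averagingIntegral q x η = 2 := by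
  have hii : ∀ a b : ℝ, IntervalIntegrable q volume a b := fun a b =>
    (hq.integrableOn_isCompact isCompact_uIcc).intervalIntegrable
  set g : ℝ → ℝ := fun t => ∫ ξ in (x - t)..(x + t), q ξ with hg
  have hgc : Continuous g := by
    have h0 : Continuous fun b : ℝ => ∫ ξ in (0 : ℝ)..b, q ξ :=
      intervalIntegral.continuous_primitive hii 0
    have : g = fun t => (∫ ξ in (0 : ℝ)..(x + t), q ξ) - ∫ ξ in (0 : ℝ)..(x - t), q ξ := by
      funext t
      exact (intervalIntegral.integral_interval_sub_left (hii _ _) (hii _ _)).symm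
    rw [this]
    exact (h0.comp (by fun_prop)).sub (h0.comp (by fun_prop))
  have hmono : ∀ s t : ℝ, 0 ≤ s → s ≤ t → g s ≤ g t := by
    intro s t hs hst
    exact intervalIntegral.integral_mono_interval (by linarith) (by linarith) (by linarith)
      (ae_restrict_of_ae hq0) (hii _ _)
  have hg0 : g 0 = 0 := by simp [hg]
  have hnn : ∀ t : ℝ, 0 ≤ t → 0 ≤ g t := fun t ht => hg0 ▸ hmono 0 t le_rfl ht
  -- some window has positive mass
  obtain ⟨T, hT0, hT⟩ : ∃ T : ℝ, 0 ≤ T ∧ 0 < g T := by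
    by_contra! hcon
    have hz : ∀ n : ℕ, ∫⁻ ξ in Ioc (x - n) (x + n), ENNReal.ofReal (q ξ) = 0 := by
      intro n
      have h1 : g n = 0 := le_antisymm (hcon n n.cast_nonneg) (hnn n n.cast_nonneg)
      have hle : x - n ≤ x + (n : ℝ) := by have := n.cast_nonneg (α := ℝ); linarith
      have h2 : ∫ ξ in Ioc (x - n) (x + n), q ξ = 0 := by
        rw [← intervalIntegral.integral_of_le hle]; exact h1
      rw [← ofReal_integral_eq_lintegral_ofReal
        ((intervalIntegrable_iff_integrableOn_Ioc_of_le hle).1 (hii _ _))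
        (ae_restrict_of_ae hq0), h2, ENNReal.ofReal_zero]
    have hU : (⋃ n : ℕ, Ioc (x - n) (x + n)) = univ := by
      refine eq_univ_of_forall fun y => mem_iUnion.2 ?_
      obtain ⟨n, hn⟩ := exists_nat_gt |y - x|
      have := abs_lt.1 hn
      exact ⟨n, by constructor <;> linarith⟩
    have hall : ∫⁻ ξ in univ, ENNReal.ofReal (q ξ) = 0 := by
      rw [← hU]
      refine le_antisymm ((lintegral_iUnion_le _ _).trans ?_) bot_le
      simp [hz]
    have := (hpos x).1.trans_le (lintegral_mono_set (subset_univ (Iic x)))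
    exact this.ne' hall
  have hgi : ∀ a b : ℝ, IntervalIntegrable g volume a b := fun a b => hgc.intervalIntegrable a b
  have h2 : (0 : ℝ) < √2 := by positivity
  have hF : ∀ η, averagingIntegral q x η = ∫ t in (0 : ℝ)..(√2 * η), g t := fun η => rfl
  have hFc : Continuous (averagingIntegral q x) := by
    have := (intervalIntegral.continuous_primitive hgi 0).comp (continuous_const_mul √2)
    exact this
  have hF0 : averagingIntegral q x 0 = 0 := by simp [hF]
  -- the integral over a longer interval exceeds by the length times the left value
  have hstep : ∀ s t : ℝ, 0 ≤ s → s ≤ t →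
      (t - s) * g s ≤ (∫ r in (0 : ℝ)..t, g r) - ∫ r in (0 : ℝ)..s, g r := by
    intro s t hs hst
    rw [intervalIntegral.integral_interval_sub_left (hgi _ _) (hgi _ _)]
    have := intervalIntegral.integral_mono_on hst (intervalIntegrable_const (c := g s)) (hgi s t)
      (fun r hr => hmono s r hs hr.1)
    simpa using this
  obtain ⟨R, hR0, hR⟩ : ∃ R : ℝ, 0 ≤ R ∧ 2 ≤ averagingIntegral q x R := by
    refine ⟨(T + 2 / g T) / √2, by positivity, ?_⟩
    rw [hF, mul_div_cancel₀ _ h2.ne']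
    have h1 := hstep T (T + 2 / g T) hT0 (by have : 0 < 2 / g T := by positivity
                                             linarith)
    have h3 : 0 ≤ ∫ r in (0 : ℝ)..T, g r :=
      intervalIntegral.integral_nonneg hT0 fun r hr => hnn r hr.1
    have h4 : (T + 2 / g T - T) * g T = 2 := by field_simp; ring
    linarith
  obtain ⟨η, hη, hη2⟩ := intermediate_value_Icc hR0 hFc.continuousOn
    (show (2 : ℝ) ∈ Icc (averagingIntegral q x 0) (averagingIntegral q x R) from
      ⟨by rw [hF0]; norm_num, hR⟩)
  have huniq : ∀ a b : ℝ, 0 ≤ a → a < b → averagingIntegral q x a = 2 →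
      averagingIntegral q x b = 2 → False := by
    intro a b ha hab h1 h3
    have hs : 0 ≤ √2 * a := by positivity
    have hlt : √2 * a < √2 * b := mul_lt_mul_of_pos_left hab h2
    have h4 := hstep _ _ hs hlt.le
    rw [← hF, ← hF, h1, h3] at h4
    have h5 : g (√2 * a) ≤ 0 := by
      by_contra! h
      have := mul_pos (sub_pos.2 hlt) h
      linarith
    have h6 : ∫ t in (0 : ℝ)..(√2 * a), g t ≤ ∫ t in (0 : ℝ)..(√2 * a), (0 : ℝ) :=
      intervalIntegral.integral_mono_on hs (hgi _ _) intervalIntegrable_const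
        fun r hr => (hmono r _ hr.1 hr.2).trans h5
    rw [← hF, h1] at h6
    norm_num at h6
  refine ⟨η, ⟨hη.1, hη2⟩, fun η' h' => ?_⟩
  rcases lt_trichotomy η' η with h | h | h
  · exact (huniq _ _ h'.1 h h'.2 hη2).elim
  · exact h
  · exact (huniq _ _ hη.1 h hη2 h'.2).elim

/-- `d(x)` is positive and solves its defining equation. -/
theorem averagingRadius_spec (q : ℝ → ℝ) (hq : LocallyIntegrable q volume)
    (hq0 : ∀ᵐ x : ℝ, 0 ≤ q x) (hpos : PositiveTails q) (x : ℝ) :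
    0 < averagingRadius q x ∧ averagingIntegral q x (averagingRadius q x) = 2 := by
  obtain ⟨η, h, hu⟩ := existsUnique_averagingRadius q hq hq0 hpos x
  have hs : {η : ℝ | 0 ≤ η ∧ averagingIntegral q x η = 2} = {η} := by
    ext y
    exact ⟨fun hy => hu y hy, fun hy => hy ▸ h⟩
  have hd : averagingRadius q x = η := by rw [averagingRadius, hs, csInf_singleton]
  rw [hd]
  refine ⟨h.1.lt_of_ne fun h0 => ?_, h.2⟩
  have := h.2
  rw [← h0] at this
  simp [averagingIntegral] at this

end SturmLiouville

/-! The inverse of `-y'' + q y` is an integral operator whose kernel can be estimated in terms of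
`d` alone. The homogeneous equation has a nonincreasing positive solution `u` and a nondecreasing
positive solution `v` with Wronskian 1 (`exists_principalPair`), and Green's function is `G(x,t) =
u(max x t) v(min x t)`. Its diagonal `u v` is comparable to `d` (`mul_le_of_isWindow`,
`le_mul_of_isWindow`). Since `(log (v/u))' = 1/(u v)`, the square of `G(x,t)` equals `(uv)(x)
(uv)(t)` times the exponential of `-|∫ 1/(uv)|` between the two points (`sq_mul_eq`). Hence `G(x,t)`
lies between two bounds of the form `C √(d(x)d(t)) exp(-β |∫_x^t dξ/d|)`, with different `C` and
`β`.

Sufficiency: agreement of the weights, with `ε` below the decay rate of `G`, moves both weights to a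
single point. The kernel `μ(x) G(x,t) / θ(t)` is then at most a constant times `sup (μ d²/θ)`, times
`1/d` at either chosen point, times an exponential in `|∫_x^t dξ/d|` (`Agrees.kernel_le`). The
substitution `z = ∫ dξ/d` bounds its row and column integrals uniformly, and Schur's test gives
boundedness for every finite `p ≥ 1`.

Uniqueness: `v` grows at least linearly at `+∞`, where `u` is bounded, and the roles are exchanged
at `-∞`. By Hölder's inequality against `1/t`, a function of linear growth in `L_{p,μ}` would make
`μ` integrable at that end, against the divergence of its tails.

Necessity: the test function is the indicator of `[x - d(x)/2, x + d(x)/2]`. The growth argument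
identifies the solution with its Green potential, which is at least a constant times `d(x)²` on that
interval. There `μ` and `θ` are controlled by their values at `x`, so the norm inequality bounds
`μ(x) d(x)²/θ(x)`. -/

namespace SturmLiouville

/-! ### Locally absolutely continuous functions -/

namespace LocallyAC

variable {g h g' h' : ℝ → ℝ}

theorem add (hg : LocallyAC g) (hh : LocallyAC h) : LocallyAC fun x => g x + h x :=
  fun a b => (hg a b).add (hh a b)

theorem sub (hg : LocallyAC g) (hh : LocallyAC h) : LocallyAC fun x => g x - h x :=
  fun a b => (hg a b).sub (hh a b)

theorem mul (hg : LocallyAC g) (hh : LocallyAC h) : LocallyAC fun x => g x * h x :=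
  fun a b => (hg a b).fun_mul (hh a b)

theorem const_mul (c : ℝ) (hg : LocallyAC g) : LocallyAC fun x => c * g x :=
  fun a b => (hg a b).const_mul c

theorem continuous (hg : LocallyAC g) : Continuous g := by
  refine continuous_iff_continuousAt.2 fun x => ?_
  have h1 := (hg (x - 1) (x + 1)).continuousOn
  rw [uIcc_of_le (by linarith)] at h1
  exact h1.continuousAt (Icc_mem_nhds (by linarith) (by linarith))

theorem ae_differentiableAt (hg : LocallyAC g) : ∀ᵐ x : ℝ, DifferentiableAt ℝ g x := by
  have h1 : ∀ᵐ x : ℝ, ∀ n : ℕ, x ∈ uIcc (-(n : ℝ)) n → DifferentiableAt ℝ g x :=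
    ae_all_iff.2 fun n => (hg _ _).ae_differentiableAt
  filter_upwards [h1] with x hx
  obtain ⟨n, hn⟩ := exists_nat_gt |x|
  have := abs_lt.1 hn
  refine hx n ?_
  rw [uIcc_of_le (by linarith)]
  constructor <;> linarith

theorem of_integral (hg : LocallyIntegrable g) (c : ℝ) :
    LocallyAC fun x => ∫ t in c..x, g t := by
  intro a b
  have hii : IntervalIntegrable g volume (min c (min a b)) (max c (max a b)) :=
    (hg.integrableOn_isCompact isCompact_uIcc).intervalIntegrable
  have hle : min c (min a b) ≤ max c (max a b) := (min_le_left _ _).trans (le_max_left _ _)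
  refine (hii.absolutelyContinuousOnInterval_intervalIntegral (c := c) ?_).mono ?_
  · rw [uIcc_of_le hle]; exact ⟨min_le_left _ _, le_max_left _ _⟩
  · rw [uIcc_of_le hle]
    exact Icc_subset_Icc (min_le_right _ _) (le_max_right _ _)

theorem integral_eq_sub (hg : LocallyAC g) (hd : ∀ᵐ x, HasDerivAt g (g' x) x) (a b : ℝ) :
    ∫ x in a..b, g' x = g b - g a := by
  rw [← (hg a b).integral_deriv_eq_sub]
  refine intervalIntegral.integral_congr_ae ?_
  filter_upwards [hd] with x hx _
  exact hx.deriv.symm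

theorem monotone (hg : LocallyAC g) (hd : ∀ᵐ x, HasDerivAt g (g' x) x)
    (h0 : ∀ᵐ x, 0 ≤ g' x) : Monotone g := by
  intro a b hab
  have := hg.integral_eq_sub hd a b
  have h2 : 0 ≤ ∫ x in a..b, g' x :=
    intervalIntegral.integral_nonneg_of_ae hab h0
  linarith

theorem eq_of_deriv_zero (hg : LocallyAC g) (hd : ∀ᵐ x, HasDerivAt g 0 x) (a b : ℝ) :
    g a = g b := by
  have := hg.integral_eq_sub hd a b
  simp at this
  linarith

theorem of_hasDerivAt (hd : ∀ x, HasDerivAt g (g' x) x) (hc : Continuous g') : LocallyAC g := by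
  have hi : ∀ a b, IntervalIntegrable g' volume a b := fun a b => hc.intervalIntegrable a b
  have h1 := LocallyAC.of_integral (hc.locallyIntegrable (μ := volume)) 0
  have h2 : g = fun x => g 0 + ∫ t in (0 : ℝ)..x, g' t := by
    funext x
    rw [intervalIntegral.integral_eq_sub_of_hasDerivAt (fun y _ => hd y) (hi _ _)]
    ring
  rw [h2]
  intro a b
  refine AbsolutelyContinuousOnInterval.add ?_ (h1 a b)
  exact (LipschitzWith.const (g 0)).lipschitzOnWith.absolutelyContinuousOnInterval

/-- A locally absolutely continuous function whose derivative agrees almost everywhere with a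
continuous function is continuously differentiable. -/
theorem hasDerivAt_of_continuous (hg : LocallyAC g) (hd : ∀ᵐ x, HasDerivAt g (g' x) x)
    (hc : Continuous g') (x : ℝ) : HasDerivAt g (g' x) x := by
  have h2 : g = fun x => g 0 + ∫ t in (0 : ℝ)..x, g' t := by
    funext x
    rw [hg.integral_eq_sub hd]
    ring
  have h3 := (hc.integral_hasStrictDerivAt 0 x).hasDerivAt.const_add (g 0)
  rwa [← h2] at h3

end LocallyAC

/-! ### Solutions with a named derivative: Wronskian, monotonicity, positivity. -/

/-- `y` solves `-y'' + q y = f` with derivative `y' = g`. -/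
structure SolvesWith (q f y g : ℝ → ℝ) : Prop where
  hasDerivAt : ∀ x, HasDerivAt y (g x) x
  locallyAC : LocallyAC g
  ae_hasDerivAt : ∀ᵐ x, HasDerivAt g (q x * y x - f x) x

namespace SolvesWith

variable {q f y g f₁ y₁ g₁ : ℝ → ℝ}

theorem continuous_deriv (h : SolvesWith q f y g) : Continuous g := h.locallyAC.continuous

theorem locallyAC_self (h : SolvesWith q f y g) : LocallyAC y :=
  LocallyAC.of_hasDerivAt h.hasDerivAt h.continuous_deriv

theorem continuous (h : SolvesWith q f y g) : Continuous y := h.locallyAC_self.continuous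

theorem deriv_eq (h : SolvesWith q f y g) : deriv y = g := funext fun x => (h.hasDerivAt x).deriv

theorem isSolution (h : SolvesWith q f y g) : IsSolution q f y := by
  refine ⟨fun x => (h.hasDerivAt x).differentiableAt, h.locallyAC_self, ?_, ?_⟩
  · rw [h.deriv_eq]; exact h.locallyAC
  · rw [h.deriv_eq]
    filter_upwards [h.ae_hasDerivAt] with x hx
    rw [hx.deriv]; ring

theorem lin_comb (h : SolvesWith q f y g) (h₁ : SolvesWith q f₁ y₁ g₁) (a b : ℝ) :
    SolvesWith q (fun x => a * f x + b * f₁ x) (fun x => a * y x + b * y₁ x)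
      (fun x => a * g x + b * g₁ x) where
  hasDerivAt x := ((h.hasDerivAt x).const_mul a).add ((h₁.hasDerivAt x).const_mul b)
  locallyAC := (h.locallyAC.const_mul a).add (h₁.locallyAC.const_mul b)
  ae_hasDerivAt := by
    filter_upwards [h.ae_hasDerivAt, h₁.ae_hasDerivAt] with x hx hx₁
    convert! (hx.const_mul a).add (hx₁.const_mul b) using 1
    ring

/-- The Wronskian of two solutions of the homogeneous equation is constant. -/
theorem wronskian_eq (h : SolvesWith q 0 y g) (h₁ : SolvesWith q 0 y₁ g₁) (a b : ℝ) :
    g a * y₁ a - y a * g₁ a = g b * y₁ b - y b * g₁ b := by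
  refine LocallyAC.eq_of_deriv_zero (g := fun x => g x * y₁ x - y x * g₁ x)
    ((h.locallyAC.mul h₁.locallyAC_self).sub (h.locallyAC_self.mul h₁.locallyAC)) ?_ a b
  filter_upwards [h.ae_hasDerivAt, h₁.ae_hasDerivAt] with x hx hx₁
  convert! (hx.mul (h₁.hasDerivAt x)).sub ((h.hasDerivAt x).mul hx₁) using 1
  simp
  ring

theorem sub_eq_integral (h : SolvesWith q 0 y g) (a b : ℝ) :
    g b - g a = ∫ x in a..b, q x * y x := by
  rw [h.locallyAC.integral_eq_sub (g' := fun x => q x * y x)]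
  simpa using h.ae_hasDerivAt

/-- `y y'` is nondecreasing when `-y'' + q y = 0` and `q ≥ 0`. -/
theorem monotone_mul_deriv (h : SolvesWith q 0 y g) (hq : ∀ᵐ x, 0 ≤ q x) :
    Monotone fun x => y x * g x := by
  refine (h.locallyAC_self.mul h.locallyAC).monotone (g' := fun x => g x ^ 2 + q x * y x ^ 2) ?_ ?_
  · filter_upwards [h.ae_hasDerivAt] with x hx
    convert! (h.hasDerivAt x).mul hx using 1
    simp
    ring
  · filter_upwards [hq] with x hx
    positivity

/-- Since `y y'` is nondecreasing and vanishes at `x₀`, the function `y²` is minimal at `x₀`; so `y`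
never vanishes and keeps its sign. -/
theorem pos_of_deriv_eq_zero (h : SolvesWith q 0 y g) (hq : ∀ᵐ x, 0 ≤ q x) {x₀ : ℝ}
    (hy : 0 < y x₀) (hg : g x₀ = 0) (x : ℝ) : 0 < y x := by
  have hm := h.monotone_mul_deriv hq
  have hd : ∀ x, HasDerivAt (fun x => y x ^ 2) (2 * (y x * g x)) x := fun x => by
    convert! (h.hasDerivAt x).pow 2 using 1
    ring
  have hdiff : Differentiable ℝ fun x => y x ^ 2 := fun x => (hd x).differentiableAt
  have hsq : ∀ x, y x₀ ^ 2 ≤ y x ^ 2 := by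
    intro x
    rcases le_total x₀ x with hx | hx
    · refine monotoneOn_of_deriv_nonneg (convex_Ici x₀) hdiff.continuous.continuousOn
        hdiff.differentiableOn (fun z hz => ?_) self_mem_Ici hx hx
      rw [interior_Ici] at hz
      have := hm (le_of_lt hz)
      simp only [hg, mul_zero] at this
      rw [(hd z).deriv]; linarith
    · refine antitoneOn_of_deriv_nonpos (convex_Iic x₀) hdiff.continuous.continuousOn
        hdiff.differentiableOn (fun z hz => ?_) hx self_mem_Iic hx
      rw [interior_Iic] at hz
      have := hm (le_of_lt hz)
      simp only [hg, mul_zero] at this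
      rw [(hd z).deriv]; linarith
  by_contra! hx
  have hmem : (0 : ℝ) ∈ uIcc (y x) (y x₀) := by
    rw [uIcc_of_le (hx.trans hy.le)]; exact ⟨hx, hy.le⟩
  obtain ⟨z, -, hz⟩ := intermediate_value_uIcc (h.continuous.continuousOn) hmem
  have := hsq z
  rw [hz] at this
  nlinarith [sq_pos_of_pos hy]

end SolvesWith

theorem IsSolution.solvesWith {q f y : ℝ → ℝ} (h : IsSolution q f y) :
    SolvesWith q f y (deriv y) where
  hasDerivAt x := (h.1 x).hasDerivAt
  locallyAC := h.2.2.1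
  ae_hasDerivAt := by
    filter_upwards [h.2.2.2, h.2.2.1.ae_differentiableAt] with x hx hdx
    convert! hdx.hasDerivAt using 1
    linarith

/-! ### Linear differential equations with continuous coefficients -/

/-- A linear system `Y' = A(t) Y` with continuous `A` has global solutions. -/
theorem exists_linear_ode {E : Type*} [NormedAddCommGroup E] [NormedSpace ℝ E] [CompleteSpace E]
    (A : ℝ → E →L[ℝ] E) (hA : Continuous A) (Y₀ : E) :
    ∃ Y : ℝ → E, Y 0 = Y₀ ∧ ∀ t, HasDerivAt Y (A t (Y t)) t := by
  -- Write `Y = exp |m| Z` with `Z` bounded. The factor 2 makes the Volterra operator a contraction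
  -- of ratio `1/2` on the whole line at once, so no local solutions need to be glued.
  set m : ℝ → ℝ := fun x => ∫ t in (0 : ℝ)..x, 2 * ‖A t‖ with hm
  have hac : Continuous fun t => 2 * ‖A t‖ := by fun_prop
  have hmd : ∀ x, HasDerivAt m (2 * ‖A x‖) x := fun x =>
    (hac.integral_hasStrictDerivAt 0 x).hasDerivAt
  have hmc : Continuous m := continuous_iff_continuousAt.2 fun x => (hmd x).continuousAt
  have hm0 : m 0 = 0 := by simp [hm]
  have hmm : Monotone m := monotone_of_deriv_nonneg (fun x => (hmd x).differentiableAt)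
    fun x => by rw [(hmd x).deriv]; positivity
  -- the weighted Volterra operator
  set I : BoundedContinuousFunction ℝ E → ℝ → E :=
    fun Z x => ∫ t in (0 : ℝ)..x, Real.exp |m t| • A t (Z t) with hI
  have hIc : ∀ Z : BoundedContinuousFunction ℝ E,
      Continuous fun t => Real.exp |m t| • A t (Z t) := fun Z => by
    have := Z.continuous
    fun_prop
  have hIcont : ∀ Z : BoundedContinuousFunction ℝ E, Continuous (I Z) := fun Z =>
    intervalIntegral.continuous_primitive (fun a b => (hIc Z).intervalIntegrable a b) 0
  have hbound : ∀ (Z : BoundedContinuousFunction ℝ E) (x : ℝ),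
      ‖I Z x‖ ≤ ‖Z‖ / 2 * Real.exp |m x| := by
    intro Z x
    have hpt : ∀ t, ‖Real.exp |m t| • A t (Z t)‖ ≤ ‖Z‖ / 2 * (Real.exp |m t| * (2 * ‖A t‖)) := by
      intro t
      rw [norm_smul, Real.norm_of_nonneg (Real.exp_pos _).le]
      have h1 : ‖A t (Z t)‖ ≤ ‖A t‖ * ‖Z‖ :=
        (A t).le_opNorm_of_le (Z.norm_coe_le_norm t)
      have h2 := mul_le_mul_of_nonneg_left h1 (Real.exp_pos |m t|).le
      linarith
    have hcb : Continuous fun t => ‖Z‖ / 2 * (Real.exp |m t| * (2 * ‖A t‖)) := by fun_prop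
    rcases le_total 0 x with hx | hx
    · have h1 := intervalIntegral.norm_integral_le_of_norm_le hx
        (ae_of_all volume fun t _ => hpt t) (hcb.intervalIntegrable 0 x)
      have h2 : ∫ t in (0 : ℝ)..x, ‖Z‖ / 2 * (Real.exp |m t| * (2 * ‖A t‖))
          = ∫ t in (0 : ℝ)..x, ‖Z‖ / 2 * (Real.exp (m t) * (2 * ‖A t‖)) := by
        refine intervalIntegral.integral_congr fun t ht => ?_
        rw [uIcc_of_le hx] at ht
        have : 0 ≤ m t := hm0 ▸ hmm ht.1
        simp only [abs_of_nonneg this]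
      rw [h2, intervalIntegral.integral_eq_sub_of_hasDerivAt
        (f := fun t => ‖Z‖ / 2 * Real.exp (m t)) (fun t _ => ((hmd t).exp.const_mul _))
        (Continuous.intervalIntegrable (by fun_prop) _ _)] at h1
      have h3 : 0 ≤ m x := hm0 ▸ hmm hx
      rw [abs_of_nonneg h3]
      have : 0 ≤ ‖Z‖ / 2 * Real.exp (m 0) := by positivity
      exact h1.trans (by linarith)
    · have h1 := intervalIntegral.norm_integral_le_of_norm_le hx
        (ae_of_all volume fun t _ => hpt t) (hcb.intervalIntegrable x 0)
      have h2 : ∫ t in x..(0 : ℝ), ‖Z‖ / 2 * (Real.exp |m t| * (2 * ‖A t‖))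
          = ∫ t in x..(0 : ℝ), -(‖Z‖ / 2 * (Real.exp (-m t) * -(2 * ‖A t‖))) := by
        refine intervalIntegral.integral_congr fun t ht => ?_
        rw [uIcc_of_le hx] at ht
        have : m t ≤ 0 := hm0 ▸ hmm ht.2
        simp only [abs_of_nonpos this]
        ring
      rw [h2, intervalIntegral.integral_eq_sub_of_hasDerivAt
        (f := fun t => -(‖Z‖ / 2 * Real.exp (-m t)))
        (f' := fun t => -(‖Z‖ / 2 * (Real.exp (-m t) * -(2 * ‖A t‖))))
        (fun t _ => ((hmd t).neg.exp.const_mul _).neg)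
        (Continuous.intervalIntegrable (by fun_prop) _ _)] at h1
      have h3 : m x ≤ 0 := hm0 ▸ hmm hx
      rw [abs_of_nonpos h3]
      have h4 : 0 ≤ ‖Z‖ / 2 * Real.exp (-m 0) := by positivity
      rw [hI]
      simp only
      rw [intervalIntegral.integral_symm, norm_neg]
      exact h1.trans (by linarith)
  have hTb : ∀ (Z : BoundedContinuousFunction ℝ E) (x : ℝ),
      ‖Real.exp (-|m x|) • (Y₀ + I Z x)‖ ≤ ‖Y₀‖ + ‖Z‖ / 2 := by
    intro Z x
    rw [norm_smul, Real.norm_of_nonneg (Real.exp_pos _).le]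
    have h1 := (norm_add_le Y₀ (I Z x)).trans (add_le_add_right (hbound Z x) ‖Y₀‖)
    have h2 := mul_le_mul_of_nonneg_left h1 (Real.exp_pos (-|m x|)).le
    have h3 : Real.exp (-|m x|) * Real.exp |m x| = 1 := by rw [← Real.exp_add]; simp
    have h4 : Real.exp (-|m x|) ≤ 1 := Real.exp_le_one_iff.2 (by simp)
    have h5 := mul_le_mul_of_nonneg_right h4 (norm_nonneg Y₀)
    calc _ ≤ _ := h2
      _ = Real.exp (-|m x|) * ‖Y₀‖ + ‖Z‖ / 2 * (Real.exp (-|m x|) * Real.exp |m x|) := by ring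
      _ ≤ _ := by rw [h3]; linarith
  let T : BoundedContinuousFunction ℝ E → BoundedContinuousFunction ℝ E := fun Z =>
    BoundedContinuousFunction.ofNormedAddCommGroup
      (fun x => Real.exp (-|m x|) • (Y₀ + I Z x))
      (by have := hIcont Z; fun_prop) (‖Y₀‖ + ‖Z‖ / 2) (hTb Z)
  have hT : ContractingWith (1 / 2) T := by
    refine ⟨by rw [← NNReal.coe_lt_coe]; norm_num, LipschitzWith.of_dist_le_mul fun Z W => ?_⟩
    rw [BoundedContinuousFunction.dist_le (by positivity)]
    intro x
    have h1 : T Z x - T W x = Real.exp (-|m x|) • I (Z - W) x := by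
      have hsub : I (Z - W) x = I Z x - I W x := by
        simp only [hI]
        rw [← intervalIntegral.integral_sub ((hIc Z).intervalIntegrable 0 x)
          ((hIc W).intervalIntegrable 0 x)]
        refine intervalIntegral.integral_congr fun t _ => ?_
        simp [smul_sub]
      change Real.exp (-|m x|) • (Y₀ + I Z x) - Real.exp (-|m x|) • (Y₀ + I W x) = _
      rw [← smul_sub, hsub]
      congr 1
      abel
    rw [dist_eq_norm, h1, norm_smul, Real.norm_of_nonneg (Real.exp_pos _).le, dist_eq_norm]
    have h2 := mul_le_mul_of_nonneg_left (hbound (Z - W) x) (Real.exp_pos (-|m x|)).le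
    have h3 : Real.exp (-|m x|) * Real.exp |m x| = 1 := by rw [← Real.exp_add]; simp
    calc _ ≤ _ := h2
      _ = ‖Z - W‖ / 2 * (Real.exp (-|m x|) * Real.exp |m x|) := by ring
      _ = _ := by rw [h3]; push_cast; ring
  set Z := hT.fixedPoint with hZ
  have hfix : T Z = Z := hT.fixedPoint_isFixedPt
  have hval : ∀ x, Real.exp |m x| • Z x = Y₀ + I Z x := by
    intro x
    have h1 : Z x = Real.exp (-|m x|) • (Y₀ + I Z x) := by
      conv_lhs => rw [← hfix]
      rfl
    rw [h1, smul_smul, ← Real.exp_add]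
    simp
  refine ⟨fun x => Y₀ + I Z x, by simp [hI], fun t => ?_⟩
  have h1 := ((hIc Z).integral_hasStrictDerivAt 0 t).hasDerivAt.const_add Y₀
  convert! h1 using 1
  change A t (Y₀ + I Z t) = _
  rw [← hval, map_smul]

/-- The initial value problem for `-y'' + q y = 0` with locally integrable `q`. -/
theorem exists_solvesWith {q : ℝ → ℝ} (hq : LocallyIntegrable q volume) (a b : ℝ) :
    ∃ y g : ℝ → ℝ, SolvesWith q 0 y g ∧ y 0 = a ∧ g 0 = b := by
  -- The quasi-derivative `w = y' - Q y` removes `q`: the system `y' = w + Q y`, `w' = -Q w - Q² y`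
  -- has continuous coefficients, although `q` is only locally integrable.
  set Q : ℝ → ℝ := fun x => ∫ t in (0 : ℝ)..x, q t with hQ
  have hQac : LocallyAC Q := LocallyAC.of_integral hq 0
  have hQc : Continuous Q := hQac.continuous
  let p₁ := ContinuousLinearMap.fst ℝ ℝ ℝ
  let p₂ := ContinuousLinearMap.snd ℝ ℝ ℝ
  let A : ℝ → (ℝ × ℝ) →L[ℝ] (ℝ × ℝ) := fun t =>
    (p₂ + Q t • p₁).prod (-(Q t • p₂) - Q t ^ 2 • p₁)
  have hA : Continuous A := by
    refine continuous_clm_apply.2 fun y => ?_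
    change Continuous fun t => (y.2 + Q t * y.1, -(Q t * y.2) - Q t ^ 2 * y.1)
    fun_prop
  obtain ⟨Y, hY0, hY⟩ := exists_linear_ode A hA (a, b)
  have h1 : ∀ t, HasDerivAt (fun t => (Y t).1) ((Y t).2 + Q t * (Y t).1) t := fun t =>
    (hasFDerivAt_fst (𝕜 := ℝ) (E := ℝ) (F := ℝ) (p := Y t)).comp_hasDerivAt t (hY t)
  have h2 : ∀ t, HasDerivAt (fun t => (Y t).2) (-(Q t * (Y t).2) - Q t ^ 2 * (Y t).1) t := fun t =>
    (hasFDerivAt_snd (𝕜 := ℝ) (E := ℝ) (F := ℝ) (p := Y t)).comp_hasDerivAt t (hY t)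
  have hc1 : Continuous fun t => (Y t).1 :=
    continuous_iff_continuousAt.2 fun x => (h1 x).continuousAt
  have hc2 : Continuous fun t => (Y t).2 :=
    continuous_iff_continuousAt.2 fun x => (h2 x).continuousAt
  have hac1 := LocallyAC.of_hasDerivAt h1 (by fun_prop)
  have hac2 := LocallyAC.of_hasDerivAt h2 (by fun_prop)
  refine ⟨fun t => (Y t).1, fun t => (Y t).2 + Q t * (Y t).1, ⟨h1, hac2.add (hQac.mul hac1), ?_⟩,
    by simp [hY0], by simp [hY0, hQ]⟩
  filter_upwards [_root_.LocallyIntegrable.ae_hasDerivAt_integral hq] with x hx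
  convert! (h2 x).add ((hx 0).mul (h1 x)) using 1
  simp only [Pi.zero_apply, hQ]
  ring

/-! ### The principal pair of solutions -/

theorem intervalIntegrable_of_locallyIntegrable {q : ℝ → ℝ} (hq : LocallyIntegrable q volume)
    (a b : ℝ) : IntervalIntegrable q volume a b :=
  (hq.integrableOn_isCompact isCompact_uIcc).intervalIntegrable

theorem lintegral_Ioc_eq_zero {q : ℝ → ℝ} (hq : LocallyIntegrable q volume)
    (hq0 : ∀ᵐ x, 0 ≤ q x) {a b : ℝ} (hab : a ≤ b) (h : ∫ t in a..b, q t ≤ 0) :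
    ∫⁻ t in Ioc a b, ENNReal.ofReal (q t) = 0 := by
  rw [← ofReal_integral_eq_lintegral_ofReal
    ((intervalIntegrable_iff_integrableOn_Ioc_of_le hab).1
      (intervalIntegrable_of_locallyIntegrable hq a b)) (ae_restrict_of_ae hq0),
    ← intervalIntegral.integral_of_le hab, ENNReal.ofReal_of_nonpos h]

theorem PositiveTails.exists_right {q : ℝ → ℝ} (h : PositiveTails q)
    (hq : LocallyIntegrable q volume) (hq0 : ∀ᵐ x, 0 ≤ q x) (x : ℝ) :
    ∃ b, x < b ∧ 0 < ∫ t in x..b, q t := by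
  by_contra! hcon
  have hz : ∀ n : ℕ, ∫⁻ t in Ioc x (x + (n + 1)), ENNReal.ofReal (q t) = 0 := fun n => by
    have : x < x + (n + 1) := by
      have : (0 : ℝ) < n + 1 := by positivity
      linarith
    exact lintegral_Ioc_eq_zero hq hq0 this.le (hcon _ this)
  have hU : Ioi x ⊆ ⋃ n : ℕ, Ioc x (x + (n + 1)) := by
    intro y hy
    obtain ⟨n, hn⟩ := exists_nat_gt (y - x)
    exact mem_iUnion.2 ⟨n, hy, by linarith⟩
  have h1 := (h x).2
  rw [setLIntegral_congr Ioi_ae_eq_Ici.symm] at h1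
  have h2 := (lintegral_mono_set (μ := volume) hU).trans (lintegral_iUnion_le
    (fun n : ℕ => Ioc x (x + (n + 1))) fun t => ENNReal.ofReal (q t))
  simp only [hz, tsum_zero] at h2
  exact absurd h1 (not_lt.2 h2)

theorem PositiveTails.exists_left {q : ℝ → ℝ} (h : PositiveTails q)
    (hq : LocallyIntegrable q volume) (hq0 : ∀ᵐ x, 0 ≤ q x) (x : ℝ) :
    ∃ a, a < x ∧ 0 < ∫ t in a..x, q t := by
  by_contra! hcon
  have hz : ∀ n : ℕ, ∫⁻ t in Ioc (x - (n + 1)) x, ENNReal.ofReal (q t) = 0 := fun n => by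
    have : x - (n + 1) < x := by
      have : (0 : ℝ) < n + 1 := by positivity
      linarith
    exact lintegral_Ioc_eq_zero hq hq0 this.le (hcon _ this)
  have hU : Iic x ⊆ ⋃ n : ℕ, Ioc (x - (n + 1)) x := by
    intro y hy
    obtain ⟨n, hn⟩ := exists_nat_gt (x - y)
    exact mem_iUnion.2 ⟨n, by linarith, hy⟩
  have h2 := (lintegral_mono_set (μ := volume) hU).trans (lintegral_iUnion_le
    (fun n : ℕ => Ioc (x - (n + 1)) x) fun t => ENNReal.ofReal (q t))
  simp only [hz, tsum_zero] at h2
  exact absurd (h x).1 (not_lt.2 h2)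

/-- A nonincreasing and a nondecreasing positive solution of `-y'' + q y = 0` with Wronskian `1`. -/
structure PrincipalPair (q u u' v v' : ℝ → ℝ) : Prop where
  solves_u : SolvesWith q 0 u u'
  solves_v : SolvesWith q 0 v v'
  u_pos : ∀ x, 0 < u x
  v_pos : ∀ x, 0 < v x
  u'_nonpos : ∀ x, u' x ≤ 0
  v'_nonneg : ∀ x, 0 ≤ v' x
  wronskian : ∀ x, v' x * u x - u' x * v x = 1

/-- With `c, s` the fundamental system at 0, `z ↦ c(z) s'(x) - c'(x) s(z)` is positive for each `x`,
by `pos_of_deriv_eq_zero`. So every `c'(x)/s'(x)` lies above the values of `c/s` on the negative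
axis and below those on the positive axis. Taking `k = inf c/s` on the right and `l = sup c/s` on
the left, `u = c - k s` and `v = (c - l s)/(k - l)` get the required signs for themselves and their
derivatives. -/
theorem exists_principalPair {q : ℝ → ℝ} (hq : LocallyIntegrable q volume)
    (hq0 : ∀ᵐ x, 0 ≤ q x) (hpos : PositiveTails q) :
    ∃ u u' v v' : ℝ → ℝ, PrincipalPair q u u' v v' := by
  obtain ⟨c, c', hc, hc0, hc'0⟩ := exists_solvesWith hq 1 0
  obtain ⟨s, s', hs, hs0, hs'0⟩ := exists_solvesWith hq 0 1
  have hW : ∀ x, c x * s' x - c' x * s x = 1 := by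
    intro x
    have := hc.wronskian_eq hs x 0
    rw [hc0, hc'0, hs0, hs'0] at this
    linarith
  -- `z ↦ c(z) s'(x) - c'(x) s(z)` has value `1` and derivative `0` at `x`
  have hD : ∀ x z, 0 < c z * s' x - c' x * s z := by
    intro x z
    have h1 := hc.lin_comb hs (s' x) (-c' x)
    have h2 : SolvesWith q 0 (fun z => s' x * c z + -c' x * s z)
        (fun z => s' x * c' z + -c' x * s' z) := by
      convert! h1 using 1
      funext z; simp
    have h3 := h2.pos_of_deriv_eq_zero hq0 (x₀ := x) (by have := hW x; linarith) (by ring) z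
    linarith
  have hs'pos : ∀ x, 0 < s' x := fun x => by simpa [hc0, hs0] using hD x 0
  have hmono : StrictMono s := strictMono_of_deriv_pos fun x => by
    rw [(hs.hasDerivAt x).deriv]; exact hs'pos x
  have hsp : ∀ z, 0 < z → 0 < s z := fun z hz => hs0 ▸ hmono hz
  have hsn : ∀ z, z < 0 → s z < 0 := fun z hz => hs0 ▸ hmono hz
  have hright : ∀ x z, 0 < z → c' x / s' x ≤ c z / s z := fun x z hz => by
    rw [div_le_div_iff₀ (hs'pos x) (hsp z hz)]
    linarith [hD x z]
  have hleft : ∀ x z, z < 0 → c z / s z ≤ c' x / s' x := fun x z hz => by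
    have h1 : c z / s z = (-c z) / (-s z) := by rw [neg_div_neg_eq]
    rw [h1, div_le_div_iff₀ (by linarith [hsn z hz]) (hs'pos x)]
    linarith [hD x z]
  set R : Set ℝ := (fun z => c z / s z) '' Ioi 0 with hR
  set S : Set ℝ := (fun z => c z / s z) '' Iio 0 with hS
  have hRne : R.Nonempty := ⟨_, 1, by simp, rfl⟩
  have hSne : S.Nonempty := ⟨_, -1, by simp, rfl⟩
  have hRb : BddBelow R := ⟨c' 0 / s' 0, by rintro _ ⟨z, hz, rfl⟩; exact hright 0 z hz⟩
  have hSb : BddAbove S := ⟨c' 0 / s' 0, by rintro _ ⟨z, hz, rfl⟩; exact hleft 0 z hz⟩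
  set k := sInf R with hk
  set l := sSup S with hl
  have hk1 : ∀ z, 0 < z → k ≤ c z / s z := fun z hz => csInf_le hRb ⟨z, hz, rfl⟩
  have hl1 : ∀ z, z < 0 → c z / s z ≤ l := fun z hz => le_csSup hSb ⟨z, hz, rfl⟩
  have hk2 : ∀ x, c' x / s' x ≤ k := fun x =>
    le_csInf hRne (by rintro _ ⟨z, hz, rfl⟩; exact hright x z hz)
  have hl2 : ∀ x, l ≤ c' x / s' x := fun x =>
    csSup_le hSne (by rintro _ ⟨z, hz, rfl⟩; exact hleft x z hz)
  have hcomb : ∀ a b : ℝ, SolvesWith q 0 (fun z => a * c z + b * s z)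
      (fun z => a * c' z + b * s' z) := fun a b => by
    convert! hc.lin_comb hs a b using 1
    funext z; simp
  have hu := hcomb 1 (-k)
  have hv := hcomb 1 (-l)
  have hu' : ∀ x, 1 * c' x + -k * s' x ≤ 0 := fun x => by
    have := (div_le_iff₀ (hs'pos x)).1 (hk2 x)
    linarith
  have hv' : ∀ x, 0 ≤ 1 * c' x + -l * s' x := fun x => by
    have := (le_div_iff₀ (hs'pos x)).1 (hl2 x)
    linarith
  have hua : Antitone fun z => 1 * c z + -k * s z :=
    antitone_of_deriv_nonpos (fun x => (hu.hasDerivAt x).differentiableAt) fun x => by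
      rw [(hu.hasDerivAt x).deriv]; exact hu' x
  have hvm : Monotone fun z => 1 * c z + -l * s z :=
    monotone_of_deriv_nonneg (fun x => (hv.hasDerivAt x).differentiableAt) fun x => by
      rw [(hv.hasDerivAt x).deriv]; exact hv' x
  have hu0 : ∀ x, 0 ≤ 1 * c x + -k * s x := by
    have h1 : ∀ x, 0 < x → 0 ≤ 1 * c x + -k * s x := fun x hx => by
      have := (le_div_iff₀ (hsp x hx)).1 (hk1 x hx)
      linarith
    intro x
    rcases lt_or_ge 0 x with hx | hx
    · exact h1 x hx
    · exact (h1 1 one_pos).trans (hua (hx.trans zero_le_one))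
  have hv0 : ∀ x, 0 ≤ 1 * c x + -l * s x := by
    have h1 : ∀ x, x < 0 → 0 ≤ 1 * c x + -l * s x := fun x hx => by
      have := (div_le_iff_of_neg (hsn x hx)).1 (hl1 x hx)
      linarith
    intro x
    rcases lt_or_ge x 0 with hx | hx
    · exact h1 x hx
    · exact (h1 (-1) (by norm_num)).trans (hvm (by linarith : (-1 : ℝ) ≤ x))
  have hupos : ∀ x, 0 < 1 * c x + -k * s x := by
    intro x
    refine (hu0 x).lt_of_ne fun h0 => ?_
    have hx0 : ∀ y, x ≤ y → 1 * c y + -k * s y = 0 := fun y hy =>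
      le_antisymm ((hua hy).trans h0.symm.le) (hu0 y)
    have hd : 1 * c' x + -k * s' x = 0 := by
      -- A zero of a nonnegative solution is a minimum, hence a double zero, which the Wronskian of
      -- `c, s` excludes.
      have hmin : IsLocalMin (fun z => 1 * c z + -k * s z) x :=
        Eventually.of_forall fun y => by simpa only [← h0] using hu0 y
      exact hmin.hasDerivAt_eq_zero (hu.hasDerivAt x)
    have h1 : c x = k * s x := by linarith
    have h2 : c' x = k * s' x := by linarith
    have := hW x
    rw [h1, h2] at this
    linarith
  have hvpos : ∀ x, 0 < 1 * c x + -l * s x := by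
    intro x
    refine (hv0 x).lt_of_ne fun h0 => ?_
    have hd : 1 * c' x + -l * s' x = 0 := by
      have hmin : IsLocalMin (fun z => 1 * c z + -l * s z) x :=
        Eventually.of_forall fun y => by simpa only [← h0] using hv0 y
      exact hmin.hasDerivAt_eq_zero (hv.hasDerivAt x)
    have h1 : c x = l * s x := by linarith
    have h2 : c' x = l * s' x := by linarith
    have := hW x
    rw [h1, h2] at this
    linarith
  have hkl : 0 < k - l := by
    have hle : l ≤ k := (hl2 0).trans (hk2 0)
    -- If `k = l`, the two solutions coincide, so the common derivative is both `≤ 0` and `≥ 0`. The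
    -- constant 1 would then solve the equation, against the mass of `q` on the right.
    refine sub_pos.2 (hle.lt_of_ne fun heq => ?_)
    have hz : ∀ x, 1 * c' x + -k * s' x = 0 := fun x =>
      le_antisymm (hu' x) (by have := hv' x; rwa [heq] at this)
    obtain ⟨b, -, hb⟩ := hpos.exists_right hq hq0 0
    have h1 : ∀ x, 1 * c x + -k * s x = 1 := fun x => by
      have := is_const_of_deriv_eq_zero (fun x => (hu.hasDerivAt x).differentiableAt)
        (fun x => by rw [(hu.hasDerivAt x).deriv]; exact hz x) x 0
      simpa [hc0, hs0] using this
    have h2 := hu.sub_eq_integral 0 b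
    simp only [h1, hz, mul_one, sub_zero] at h2
    linarith
  refine ⟨_, _, _, _, hu, hcomb (1 / (k - l)) (-l / (k - l)), hupos, fun x => ?_, hu', fun x => ?_,
    fun x => ?_⟩
  · have : 1 / (k - l) * c x + -l / (k - l) * s x = (1 * c x + -l * s x) / (k - l) := by
      field_simp
    rw [this]
    exact div_pos (hvpos x) hkl
  · have : 1 / (k - l) * c' x + -l / (k - l) * s' x = (1 * c' x + -l * s' x) / (k - l) := by
      field_simp
    rw [this]
    exact div_nonneg (hv' x) hkl.le
  · have := hW x
    have hne := hkl.ne'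
    field_simp
    linear_combination (k - l) * this

/-! ### Two-sided estimates -/

namespace SolvesWith

variable {q y g : ℝ → ℝ}

theorem monotone_deriv (h : SolvesWith q 0 y g) (hq0 : ∀ᵐ x, 0 ≤ q x) (hy : ∀ x, 0 < y x) :
    Monotone g := by
  refine h.locallyAC.monotone (g' := fun x => q x * y x) (by simpa using h.ae_hasDerivAt) ?_
  filter_upwards [hq0] with x hx
  exact mul_nonneg hx (hy x).le

/-- A positive solution lies above its tangent lines. -/
theorem tangent_le (h : SolvesWith q 0 y g) (hq0 : ∀ᵐ x, 0 ≤ q x) (hy : ∀ x, 0 < y x) (a b : ℝ) :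
    y a + g a * (b - a) ≤ y b := by
  have hm := h.monotone_deriv hq0 hy
  rcases lt_trichotomy a b with hab | rfl | hab
  · obtain ⟨z, hz, hz2⟩ := exists_hasDerivAt_eq_slope y g hab h.continuous.continuousOn
      fun x _ => h.hasDerivAt x
    have h1 := hm hz.1.le
    rw [hz2, le_div_iff₀ (by linarith)] at h1
    linarith
  · simp
  · obtain ⟨z, hz, hz2⟩ := exists_hasDerivAt_eq_slope y g hab h.continuous.continuousOn
      fun x _ => h.hasDerivAt x
    have h1 := hm hz.2.le
    rw [hz2, div_le_iff₀ (by linarith)] at h1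
    linarith

/-- Two integrations of `y'' = q y`. The right side is the integral defining `d`, with `y` inserted,
which is how the averaging radius enters estimates of solutions. -/
theorem second_difference (h : SolvesWith q 0 y g) (x τ : ℝ) :
    y (x + τ) + y (x - τ) - 2 * y x = ∫ t in (0 : ℝ)..τ, ∫ ξ in (x - t)..(x + t), q ξ * y ξ := by
  have hgc := h.continuous_deriv
  have h1 : ∀ t, HasDerivAt (fun t => y (x + t) + y (x - t)) (g (x + t) - g (x - t)) t := fun t => by
    convert! ((h.hasDerivAt (x + t)).comp_const_add x t).add
      ((h.hasDerivAt (x - t)).comp_const_sub x t) using 1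
  simp only [← h.sub_eq_integral]
  rw [intervalIntegral.integral_eq_sub_of_hasDerivAt (fun t _ => h1 t)
    (Continuous.intervalIntegrable (by fun_prop) _ _)]
  simp
  ring

end SolvesWith

theorem continuous_symm_integral {q : ℝ → ℝ} (hq : LocallyIntegrable q volume) (x : ℝ) :
    Continuous fun t : ℝ => ∫ ξ in (x - t)..(x + t), q ξ := by
  have hii := intervalIntegrable_of_locallyIntegrable hq
  have h0 : Continuous fun b : ℝ => ∫ ξ in (0 : ℝ)..b, q ξ :=
    intervalIntegral.continuous_primitive hii 0
  have : (fun t : ℝ => ∫ ξ in (x - t)..(x + t), q ξ) =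
      fun t => (∫ ξ in (0 : ℝ)..(x + t), q ξ) - ∫ ξ in (0 : ℝ)..(x - t), q ξ := by
    funext t
    exact (intervalIntegral.integral_interval_sub_left (hii _ _) (hii _ _)).symm
  rw [this]
  exact (h0.comp (by fun_prop)).sub (h0.comp (by fun_prop))

theorem symm_integral_mono {q : ℝ → ℝ} (hq : LocallyIntegrable q volume) (hq0 : ∀ᵐ x, 0 ≤ q x)
    {x x' s t : ℝ} (hs : 0 ≤ s) (hst : |x - x'| + s ≤ t) :
    ∫ ξ in (x - s)..(x + s), q ξ ≤ ∫ ξ in (x' - t)..(x' + t), q ξ := by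
  have h1 := abs_le.1 (le_refl |x - x'|)
  exact intervalIntegral.integral_mono_interval (by linarith) (by linarith) (by linarith)
    (ae_restrict_of_ae hq0) (intervalIntegrable_of_locallyIntegrable hq _ _)

theorem integral_mono_on_ae {f g : ℝ → ℝ} {a b : ℝ} (hab : a ≤ b)
    (hf : IntervalIntegrable f volume a b) (hg : IntervalIntegrable g volume a b)
    (h : ∀ᵐ x, x ∈ Icc a b → f x ≤ g x) : ∫ x in a..b, f x ≤ ∫ x in a..b, g x :=
  intervalIntegral.integral_mono_ae_restrict hab hf hg
    ((ae_restrict_iff' measurableSet_Icc).2 h)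

/-! ### Averaging windows and their comparison with `u v`. -/

/-- `s` is the half-width `√2 d(x)` of the averaging window at `x`. -/
def IsWindow (q : ℝ → ℝ) (x s : ℝ) : Prop :=
  0 < s ∧ ∫ t in (0 : ℝ)..s, ∫ ξ in (x - t)..(x + t), q ξ = 2

theorem isWindow_averagingRadius {q : ℝ → ℝ} (hq : LocallyIntegrable q volume)
    (hq0 : ∀ᵐ x, 0 ≤ q x) (hpos : PositiveTails q) (x : ℝ) :
    IsWindow q x (√2 * averagingRadius q x) :=
  ⟨mul_pos (by positivity) (averagingRadius_spec q hq hq0 hpos x).1,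
    (averagingRadius_spec q hq hq0 hpos x).2⟩

namespace IsWindow

variable {q : ℝ → ℝ} {x x' s s' : ℝ}

/-- The inner integral is nondecreasing in `t`, so its mean over the first quarter of `[0, s]` is at
most its mean over the rest; the total is 2. -/
theorem integral_quarter_le (h : IsWindow q x s) (hq : LocallyIntegrable q volume)
    (hq0 : ∀ᵐ x, 0 ≤ q x) :
    ∫ t in (0 : ℝ)..(s / 4), ∫ ξ in (x - t)..(x + t), q ξ ≤ 1 / 2 := by
  have hs := h.1
  set H : ℝ → ℝ := fun t => ∫ ξ in (x - t)..(x + t), q ξ with hH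
  have hHc : Continuous H := continuous_symm_integral hq x
  have hi : ∀ a b, IntervalIntegrable H volume a b := fun a b => hHc.intervalIntegrable a b
  have hm : ∀ a b, 0 ≤ a → a ≤ b → H a ≤ H b := fun a b ha hab =>
    symm_integral_mono hq hq0 ha (by simpa using hab)
  have h1 : ∫ t in (0 : ℝ)..(s / 4), H t ≤ ∫ t in (0 : ℝ)..(s / 4), H (s / 4) :=
    intervalIntegral.integral_mono_on (by positivity) (hi _ _) (by simp)
      fun t ht => hm _ _ ht.1 ht.2
  have h2 : ∫ t in (s / 4)..s, H (s / 4) ≤ ∫ t in (s / 4)..s, H t :=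
    intervalIntegral.integral_mono_on (by linarith) (by simp) (hi _ _)
      fun t ht => hm _ _ (by positivity) ht.1
  have h3 := intervalIntegral.integral_add_adjacent_intervals (hi 0 (s / 4)) (hi (s / 4) s)
  have h4 : ∫ t in (0 : ℝ)..s, H t = 2 := h.2
  rw [h4] at h3
  simp only [intervalIntegral.integral_const, smul_eq_mul] at h1 h2
  linarith

/-- The half-width is `1`-Lipschitz in the centre. -/
theorem le_add (h : IsWindow q x s) (h' : IsWindow q x' s') (hq : LocallyIntegrable q volume)
    (hq0 : ∀ᵐ x, 0 ≤ q x) : s' ≤ s + |x - x'| := by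
  by_contra! hlt
  set δ := |x - x'| with hδ
  have hδ0 : 0 ≤ δ := abs_nonneg _
  have hs := h.1
  set H : ℝ → ℝ := fun t => ∫ ξ in (x - t)..(x + t), q ξ with hH
  set H' : ℝ → ℝ := fun t => ∫ ξ in (x' - t)..(x' + t), q ξ with hH'
  have hHc : Continuous H := continuous_symm_integral hq x
  have hHc' : Continuous H' := continuous_symm_integral hq x'
  have hi : ∀ a b, IntervalIntegrable H volume a b := fun a b => hHc.intervalIntegrable a b
  have hi' : ∀ a b, IntervalIntegrable H' volume a b := fun a b => hHc'.intervalIntegrable a b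
  have hm' : ∀ a b, 0 ≤ a → a ≤ b → H' a ≤ H' b := fun a b ha hab =>
    symm_integral_mono hq hq0 ha (by simpa using hab)
  have hnn : ∀ a, 0 ≤ a → 0 ≤ H' a := fun a ha => by
    have := hm' 0 a le_rfl ha
    simpa [hH'] using this
  -- The interval of radius `t` about `x` lies in that of radius `t + δ` about `x'`, so `H'` already
  -- has integral at least 2 over `[δ, s + δ]`. If `s' > s + δ`, nothing is left for `[s + δ, s']`;
  -- by monotonicity `H'` then vanishes up to `s + δ`, a contradiction.
  have h1 : ∫ t in (0 : ℝ)..s, H t ≤ ∫ t in (0 : ℝ)..s, H' (t + δ) :=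
    intervalIntegral.integral_mono_on hs.le (hi _ _)
      (Continuous.intervalIntegrable (by fun_prop) _ _)
      fun t ht => symm_integral_mono hq hq0 ht.1 (by rw [← hδ]; linarith)
  rw [intervalIntegral.integral_comp_add_right (f := H'), zero_add] at h1
  have hH2 : ∫ t in (0 : ℝ)..s, H t = 2 := h.2
  have hH2' : ∫ t in (0 : ℝ)..s', H' t = 2 := h'.2
  have h2 := intervalIntegral.integral_add_adjacent_intervals (hi' 0 δ) (hi' δ (s + δ))
  have h3 := intervalIntegral.integral_add_adjacent_intervals (hi' 0 (s + δ)) (hi' (s + δ) s')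
  have h4 : 0 ≤ ∫ t in (0 : ℝ)..δ, H' t :=
    intervalIntegral.integral_nonneg hδ0 fun t ht => hnn t ht.1
  have h5 : ∫ t in (s + δ)..s', H' (s + δ) ≤ ∫ t in (s + δ)..s', H' t :=
    intervalIntegral.integral_mono_on hlt.le (by simp) (hi' _ _)
      fun t ht => hm' _ _ (by positivity) ht.1
  simp only [intervalIntegral.integral_const, smul_eq_mul] at h5
  have h6 : δ ≤ s + δ := by linarith
  have h7 : ∫ t in δ..(s + δ), H' t ≤ ∫ t in δ..(s + δ), H' (s + δ) :=
    intervalIntegral.integral_mono_on h6 (hi' _ _) (by simp)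
      fun t ht => hm' _ _ (hδ0.trans ht.1) ht.2
  simp only [intervalIntegral.integral_const, smul_eq_mul] at h7
  have h8 : 0 < s' - (s + δ) := by linarith
  have h9 : 0 ≤ H' (s + δ) := hnn _ (by positivity)
  have h10 : (s' - (s + δ)) * H' (s + δ) ≤ 0 := by linarith
  have h11 : H' (s + δ) ≤ 0 := by
    by_contra! h
    have := mul_pos h8 h
    linarith
  have h12 : (s + δ - δ) * H' (s + δ) ≤ 0 := by
    rw [le_antisymm h11 h9, mul_zero]
  linarith

end IsWindow

namespace PrincipalPair

variable {q u u' v v' : ℝ → ℝ}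

theorem antitone_u (h : PrincipalPair q u u' v v') : Antitone u :=
  antitone_of_deriv_nonpos (fun x => (h.solves_u.hasDerivAt x).differentiableAt) fun x => by
    rw [(h.solves_u.hasDerivAt x).deriv]; exact h.u'_nonpos x

theorem monotone_v (h : PrincipalPair q u u' v v') : Monotone v :=
  monotone_of_deriv_nonneg (fun x => (h.solves_v.hasDerivAt x).differentiableAt) fun x => by
    rw [(h.solves_v.hasDerivAt x).deriv]; exact h.v'_nonneg x

/-- If `u v > 2 s` at `x`, the Wronskian makes the slopes so small that, by the tangent lines, `u ≥
u(x)/2` on `[x, x+s]` and `v ≥ v(x)/2` on `[x-s, x]`. Integrating `u'' = q u` and `v'' = q v` and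
using the Wronskian again gives `∫_{x-t}^{x+t} q ≤ 1/s` for `t ≤ s`, so the window integral is at
most 1 instead of 2. -/
theorem mul_le_of_isWindow (h : PrincipalPair q u u' v v') (hq : LocallyIntegrable q volume)
    (hq0 : ∀ᵐ x, 0 ≤ q x) {x s : ℝ} (hs : IsWindow q x s) : u x * v x ≤ 2 * s := by
  by_contra! hlt
  have hu := h.u_pos x
  have hv := h.v_pos x
  have hW := h.wronskian x
  have hs0 := hs.1
  have hu' : 0 ≤ -u' x * v x := mul_nonneg (by linarith [h.u'_nonpos x]) hv.le
  have hv' : 0 ≤ v' x * u x := mul_nonneg (h.v'_nonneg x) hu.le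
  have hii := intervalIntegrable_of_locallyIntegrable hq
  have hus : -u' x * s ≤ u x / 2 := by
    have : -u' x * s * v x ≤ u x / 2 * v x := by nlinarith
    exact le_of_mul_le_mul_right this hv
  have hvs : v' x * s ≤ v x / 2 := by
    have : v' x * s * u x ≤ v x / 2 * u x := by nlinarith
    exact le_of_mul_le_mul_right this hu
  have hright : ∀ t ∈ Icc 0 s, u x / 2 * ∫ ξ in x..(x + t), q ξ ≤ -u' x := by
    intro t ht
    have h1 := h.solves_u.sub_eq_integral x (x + t)
    have h2 : ∫ ξ in x..(x + t), u x / 2 * q ξ ≤ ∫ ξ in x..(x + t), q ξ * u ξ := by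
      refine integral_mono_on_ae (by linarith [ht.1])
        ((hii _ _).const_mul _) ((hii _ _).mul_continuousOn h.solves_u.continuous.continuousOn) ?_
      filter_upwards [hq0] with ξ hξ hmem
      have h3 := h.solves_u.tangent_le hq0 h.u_pos x ξ
      have h4 : -u' x * (ξ - x) ≤ -u' x * s :=
        mul_le_mul_of_nonneg_left (by linarith [hmem.2, ht.2]) (by linarith [h.u'_nonpos x])
      have h5 : u x / 2 ≤ u ξ := by linarith
      rw [mul_comm]
      exact mul_le_mul_of_nonneg_left h5 hξ
    rw [intervalIntegral.integral_const_mul] at h2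
    have h6 := h.u'_nonpos (x + t)
    linarith
  have hleft : ∀ t ∈ Icc 0 s, v x / 2 * ∫ ξ in (x - t)..x, q ξ ≤ v' x := by
    intro t ht
    have h1 := h.solves_v.sub_eq_integral (x - t) x
    have h2 : ∫ ξ in (x - t)..x, v x / 2 * q ξ ≤ ∫ ξ in (x - t)..x, q ξ * v ξ := by
      refine integral_mono_on_ae (by linarith [ht.1])
        ((hii _ _).const_mul _) ((hii _ _).mul_continuousOn h.solves_v.continuous.continuousOn) ?_
      filter_upwards [hq0] with ξ hξ hmem
      have h3 := h.solves_v.tangent_le hq0 h.v_pos x ξ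
      have h4 : v' x * (x - ξ) ≤ v' x * s :=
        mul_le_mul_of_nonneg_left (by linarith [hmem.1, ht.2]) (h.v'_nonneg x)
      have h5 : v x / 2 ≤ v ξ := by linarith
      rw [mul_comm]
      exact mul_le_mul_of_nonneg_left h5 hξ
    rw [intervalIntegral.integral_const_mul] at h2
    have h6 := h.v'_nonneg (x - t)
    linarith
  have hsum : ∀ t ∈ Icc 0 s, ∫ ξ in (x - t)..(x + t), q ξ ≤ 1 / s := by
    intro t ht
    rw [← intervalIntegral.integral_add_adjacent_intervals (hii (x - t) x) (hii x (x + t))]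
    have h1 := mul_le_mul_of_nonneg_left (hright t ht) hv.le
    have h2 := mul_le_mul_of_nonneg_left (hleft t ht) hu.le
    set A := ∫ ξ in (x - t)..x, q ξ
    set B := ∫ ξ in x..(x + t), q ξ
    have h3 : u x * v x / 2 * (A + B) ≤ 1 := by linarith
    have h4 : 0 ≤ A + B := add_nonneg
      (intervalIntegral.integral_nonneg_of_ae (by linarith [ht.1]) hq0)
      (intervalIntegral.integral_nonneg_of_ae (by linarith [ht.1]) hq0)
    rw [le_div_iff₀ hs0]
    nlinarith
  have hfin : ∫ t in (0 : ℝ)..s, ∫ ξ in (x - t)..(x + t), q ξ ≤ ∫ t in (0 : ℝ)..s, 1 / s :=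
    intervalIntegral.integral_mono_on hs0.le
      ((continuous_symm_integral hq x).intervalIntegrable _ _) (by simp) hsum
  rw [hs.2] at hfin
  simp only [intervalIntegral.integral_const, smul_eq_mul, sub_zero] at hfin
  rw [mul_one_div_cancel hs0.ne'] at hfin
  norm_num at hfin

/-- On the quarter window, of radius `τ = s/4`, the second difference of a positive solution is at
most half its maximum. So `v(x+τ) ≤ 4 v(x)` and `u(x-τ) ≤ 4 u(x)`; tangent lines turn this into `v'
τ ≤ 3 v` and `-u' τ ≤ 3 u` at `x`, and the Wronskian yields `τ ≤ 6 u v`. -/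
theorem le_mul_of_isWindow (h : PrincipalPair q u u' v v') (hq : LocallyIntegrable q volume)
    (hq0 : ∀ᵐ x, 0 ≤ q x) {x s : ℝ} (hs : IsWindow q x s) : s / 24 ≤ u x * v x := by
  have hu := h.u_pos x
  have hv := h.v_pos x
  have hW := h.wronskian x
  have hs0 := hs.1
  have hii := intervalIntegrable_of_locallyIntegrable hq
  set τ := s / 4 with hτ
  have hτ0 : 0 < τ := by positivity
  have hquarter := hs.integral_quarter_le hq hq0
  have key : ∀ (y g : ℝ → ℝ) (M : ℝ), SolvesWith q 0 y g → (∀ z, 0 < y z) →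
      (∀ z ∈ Icc (x - τ) (x + τ), y z ≤ M) →
      y (x + τ) + y (x - τ) - 2 * y x ≤ M / 2 := by
    intro y g M hy hpos hM
    have hM0 : 0 ≤ M := (hpos x).le.trans (hM x ⟨by linarith, by linarith⟩)
    rw [hy.second_difference]
    have h1 : ∫ t in (0 : ℝ)..τ, ∫ ξ in (x - t)..(x + t), q ξ * y ξ ≤
        ∫ t in (0 : ℝ)..τ, M * ∫ ξ in (x - t)..(x + t), q ξ := by
      have hloc : LocallyIntegrable (fun ξ => q ξ * y ξ) volume := by
        have := hq.smul_continuous hy.continuous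
        simpa [mul_comm] using this
      refine intervalIntegral.integral_mono_on hτ0.le
        ((continuous_symm_integral hloc x).intervalIntegrable _ _)
        (((continuous_symm_integral hq x).const_mul M).intervalIntegrable _ _) fun t ht => ?_
      rw [← intervalIntegral.integral_const_mul]
      refine integral_mono_on_ae (by linarith [ht.1])
        ((hii _ _).mul_continuousOn hy.continuous.continuousOn) ((hii _ _).const_mul _) ?_
      filter_upwards [hq0] with ξ hξ hmem
      rw [mul_comm M]
      exact mul_le_mul_of_nonneg_left
        (hM ξ ⟨by linarith [hmem.1, ht.2], by linarith [hmem.2, ht.2]⟩) hξ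
    rw [intervalIntegral.integral_const_mul] at h1
    nlinarith
  have hv4 : v (x + τ) ≤ 4 * v x := by
    have := key v v' (v (x + τ)) h.solves_v h.v_pos fun z hz => h.monotone_v hz.2
    linarith [h.v_pos (x - τ)]
  have hu4 : u (x - τ) ≤ 4 * u x := by
    have := key u u' (u (x - τ)) h.solves_u h.u_pos fun z hz => h.antitone_u hz.1
    linarith [h.u_pos (x + τ)]
  have hv' : v' x * τ ≤ 3 * v x := by
    have := h.solves_v.tangent_le hq0 h.v_pos x (x + τ)
    simp only [add_sub_cancel_left] at this
    linarith
  have hu' : -u' x * τ ≤ 3 * u x := by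
    have := h.solves_u.tangent_le hq0 h.u_pos x (x - τ)
    have h2 : x - τ - x = -τ := by ring
    rw [h2] at this
    linarith
  have h1 := mul_le_mul_of_nonneg_right hv' hu.le
  have h2 := mul_le_mul_of_nonneg_right hu' hv.le
  have h3 : τ * 1 ≤ 6 * (u x * v x) := by rw [← hW]; linarith
  linarith

/-- By the Wronskian, `log v - log u` has derivative `1/(u v)`. Thus Green's function is determined
by its diagonal. -/
theorem sq_mul_eq (h : PrincipalPair q u u' v v') (t x : ℝ) :
    (u x * v t) ^ 2 = (u x * v x) * (u t * v t) *
      Real.exp (-∫ ξ in t..x, 1 / (u ξ * v ξ)) := by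
  have hcu := h.solves_u.continuous
  have hcv := h.solves_v.continuous
  have hne : ∀ ξ, u ξ * v ξ ≠ 0 := fun ξ => (mul_pos (h.u_pos ξ) (h.v_pos ξ)).ne'
  have hd : ∀ ξ, HasDerivAt (fun ξ => Real.log (v ξ) - Real.log (u ξ)) (1 / (u ξ * v ξ)) ξ := by
    intro ξ
    convert! ((h.solves_v.hasDerivAt ξ).log (h.v_pos ξ).ne').sub
      ((h.solves_u.hasDerivAt ξ).log (h.u_pos ξ).ne') using 1
    have := h.wronskian ξ
    have h1 := (h.u_pos ξ).ne'
    have h2 := (h.v_pos ξ).ne'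
    field_simp
    linarith
  rw [intervalIntegral.integral_eq_sub_of_hasDerivAt (fun ξ _ => hd ξ)
    (Continuous.intervalIntegrable
      (continuous_const.div (by fun_prop) hne) _ _)]
  have : -(Real.log (v x) - Real.log (u x) - (Real.log (v t) - Real.log (u t))) =
      Real.log (u x) + Real.log (v t) - Real.log (v x) - Real.log (u t) := by ring
  rw [this, Real.exp_sub, Real.exp_sub, Real.exp_add, Real.exp_log (h.u_pos x),
    Real.exp_log (h.v_pos t), Real.exp_log (h.v_pos x), Real.exp_log (h.u_pos t)]
  have h1 := (h.u_pos t).ne'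
  have h2 := (h.v_pos x).ne'
  field_simp

end PrincipalPair

/-! ### The averaging radius and the induced distance -/

section Averaging

variable {q : ℝ → ℝ}

theorem averagingRadius_pos (hq : LocallyIntegrable q volume) (hq0 : ∀ᵐ x, 0 ≤ q x)
    (hpos : PositiveTails q) (x : ℝ) : 0 < averagingRadius q x :=
  (averagingRadius_spec q hq hq0 hpos x).1

theorem averagingRadius_le_add (hq : LocallyIntegrable q volume) (hq0 : ∀ᵐ x, 0 ≤ q x)
    (hpos : PositiveTails q) (x x' : ℝ) :
    √2 * averagingRadius q x' ≤ √2 * averagingRadius q x + |x - x'| :=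
  (isWindow_averagingRadius hq hq0 hpos x).le_add (isWindow_averagingRadius hq hq0 hpos x') hq hq0

theorem continuous_averagingRadius (hq : LocallyIntegrable q volume) (hq0 : ∀ᵐ x, 0 ≤ q x)
    (hpos : PositiveTails q) : Continuous (averagingRadius q) := by
  have h1 : LipschitzWith 1 fun x => √2 * averagingRadius q x := by
    refine LipschitzWith.of_dist_le_mul fun x x' => ?_
    rw [Real.dist_eq, Real.dist_eq, NNReal.coe_one, one_mul, abs_sub_le_iff]
    have := averagingRadius_le_add hq hq0 hpos x x'
    have h2 := averagingRadius_le_add hq hq0 hpos x' x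
    rw [abs_sub_comm] at h2
    constructor <;> linarith
  have h2 : averagingRadius q = fun x => (√2)⁻¹ * (√2 * averagingRadius q x) := by
    funext x
    rw [inv_mul_cancel_left₀ (by positivity)]
  rw [h2]
  exact h1.continuous.const_mul _

theorem continuous_one_div_averagingRadius (hq : LocallyIntegrable q volume)
    (hq0 : ∀ᵐ x, 0 ≤ q x) (hpos : PositiveTails q) :
    Continuous fun x => 1 / averagingRadius q x :=
  continuous_const.div (continuous_averagingRadius hq hq0 hpos)
    fun x => (averagingRadius_pos hq hq0 hpos x).ne'

end Averaging

theorem averagingDist_comm (q : ℝ → ℝ) (x t : ℝ) : averagingDist q x t = averagingDist q t x := by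
  rw [averagingDist, averagingDist, intervalIntegral.integral_symm, abs_neg]

/-! ### Green's function -/

/-- Green's function of `-y'' + q y` built from a principal pair. -/
def green (u v : ℝ → ℝ) (x t : ℝ) : ℝ := u (max x t) * v (min x t)

theorem green_comm (u v : ℝ → ℝ) (x t : ℝ) : green u v x t = green u v t x := by
  rw [green, green, max_comm, min_comm]

namespace PrincipalPair

variable {q u u' v v' : ℝ → ℝ}

theorem green_pos (h : PrincipalPair q u u' v v') (x t : ℝ) : 0 < green u v x t :=
  mul_pos (h.u_pos _) (h.v_pos _)

theorem continuous_green (h : PrincipalPair q u u' v v') :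
    Continuous fun z : ℝ × ℝ => green u v z.1 z.2 :=
  (h.solves_u.continuous.comp (continuous_fst.max continuous_snd)).mul
    (h.solves_v.continuous.comp (continuous_fst.min continuous_snd))

/-- From `u v ≤ 2√2 d ≤ 3 d`: the exponent in `sq_mul_eq` is at least a third of the distance, and
the square root halves it to `1/6`. -/
theorem green_le (h : PrincipalPair q u u' v v') (hq : LocallyIntegrable q volume)
    (hq0 : ∀ᵐ x, 0 ≤ q x) (hpos : PositiveTails q) (x t : ℝ) :
    green u v x t ≤ 3 * √(averagingRadius q x * averagingRadius q t) *
      Real.exp (-(1 / 6) * averagingDist q x t) := by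
  wlog htx : t ≤ x generalizing x t
  · rw [green_comm, mul_comm (averagingRadius q x), averagingDist_comm]
    exact this t x (le_of_not_ge htx)
  have hd := averagingRadius_pos hq hq0 hpos
  have hρ : ∀ z, u z * v z ≤ 2 * (√2 * averagingRadius q z) := fun z =>
    h.mul_le_of_isWindow hq hq0 (isWindow_averagingRadius hq hq0 hpos z)
  have hρ0 : ∀ z, 0 < u z * v z := fun z => mul_pos (h.u_pos z) (h.v_pos z)
  have h2 : √2 ^ 2 = 2 := Real.sq_sqrt (by norm_num)
  have h3 : √2 ≤ 3 / 2 := by rw [Real.sqrt_le_left (by norm_num)]; norm_num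
  have hc1 := continuous_one_div_averagingRadius hq hq0 hpos
  have hc2 : Continuous fun ξ => 1 / (u ξ * v ξ) :=
    continuous_const.div (h.solves_u.continuous.mul h.solves_v.continuous) fun ξ => (hρ0 ξ).ne'
  have hint : 1 / 3 * averagingDist q x t ≤ ∫ ξ in t..x, 1 / (u ξ * v ξ) := by
    rw [averagingDist_comm, averagingDist, abs_of_nonneg
      (intervalIntegral.integral_nonneg htx fun z _ => (one_div_pos.2 (hd z)).le),
      ← intervalIntegral.integral_const_mul]
    refine intervalIntegral.integral_mono_on htx ((hc1.const_mul _).intervalIntegrable _ _)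
      (hc2.intervalIntegrable _ _) fun z _ => ?_
    rw [one_div_mul_one_div]
    refine one_div_le_one_div_of_le (hρ0 z) ((hρ z).trans ?_)
    nlinarith [hd z]
  refine abs_le_of_sq_le_sq' ?_ (by positivity) |>.2
  rw [green, max_eq_left htx, min_eq_right htx, h.sq_mul_eq t x, mul_pow, mul_pow,
    Real.sq_sqrt (mul_pos (hd x) (hd t)).le, ← Real.exp_nat_mul]
  refine mul_le_mul ?_ (Real.exp_le_exp.2 ?_) (Real.exp_pos _).le (by positivity [hd x, hd t])
  · have := mul_le_mul (hρ x) (hρ t) (hρ0 t).le (by have := hd x; positivity)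
    have h4 := mul_pos (hd x) (hd t)
    calc _ ≤ _ := this
      _ = 4 * √2 ^ 2 * (averagingRadius q x * averagingRadius q t) := by ring
      _ ≤ _ := by rw [h2]; nlinarith
  · push_cast
    linarith

/-- From `d/24 ≤ u v`: the exponent in `sq_mul_eq` is at most 24 times the distance, halved by the
square root. -/
theorem le_green (h : PrincipalPair q u u' v v') (hq : LocallyIntegrable q volume)
    (hq0 : ∀ᵐ x, 0 ≤ q x) (hpos : PositiveTails q) (x t : ℝ) :
    1 / 24 * √(averagingRadius q x * averagingRadius q t) *
      Real.exp (-12 * averagingDist q x t) ≤ green u v x t := by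
  wlog htx : t ≤ x generalizing x t
  · rw [green_comm, mul_comm (averagingRadius q x), averagingDist_comm]
    exact this t x (le_of_not_ge htx)
  have hd := averagingRadius_pos hq hq0 hpos
  have h1 : 1 ≤ √2 := by rw [Real.one_le_sqrt]; norm_num
  have hρ : ∀ z, averagingRadius q z / 24 ≤ u z * v z := fun z =>
    le_trans (by nlinarith [hd z])
      (h.le_mul_of_isWindow hq hq0 (isWindow_averagingRadius hq hq0 hpos z))
  have hρ0 : ∀ z, 0 < u z * v z := fun z => mul_pos (h.u_pos z) (h.v_pos z)
  have hc1 := continuous_one_div_averagingRadius hq hq0 hpos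
  have hc2 : Continuous fun ξ => 1 / (u ξ * v ξ) :=
    continuous_const.div (h.solves_u.continuous.mul h.solves_v.continuous) fun ξ => (hρ0 ξ).ne'
  have hint : ∫ ξ in t..x, 1 / (u ξ * v ξ) ≤ 24 * averagingDist q x t := by
    rw [averagingDist_comm, averagingDist, abs_of_nonneg
      (intervalIntegral.integral_nonneg htx fun z _ => (one_div_pos.2 (hd z)).le),
      ← intervalIntegral.integral_const_mul]
    refine intervalIntegral.integral_mono_on htx (hc2.intervalIntegrable _ _)
      ((hc1.const_mul _).intervalIntegrable _ _) fun z _ => ?_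
    have := one_div_le_one_div_of_le (by have := hd z; positivity) (hρ z)
    rwa [one_div_div, div_eq_mul_one_div 24] at this
  refine abs_le_of_sq_le_sq' ?_ (h.green_pos x t).le |>.2
  rw [green, max_eq_left htx, min_eq_right htx, h.sq_mul_eq t x, mul_pow, mul_pow,
    Real.sq_sqrt (mul_pos (hd x) (hd t)).le, ← Real.exp_nat_mul]
  refine mul_le_mul ?_ (Real.exp_le_exp.2 ?_) (Real.exp_pos _).le
    (mul_pos (hρ0 x) (hρ0 t)).le
  · have := mul_le_mul (hρ x) (hρ t) (by have := hd t; positivity) (hρ0 x).le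
    calc _ = averagingRadius q x / 24 * (averagingRadius q t / 24) := by ring
      _ ≤ _ := this
  · push_cast
    linarith

end PrincipalPair

/-- Agreement of `θ` moves `√d(t)/θ(t)` to `x`, and agreement of `μ` moves `μ(x) √d(x)` to `t`.
Either way `μ d²/θ` appears at one point with a factor `1/d` left over. The first bound serves
integration in `x`, the second integration in `t`. -/
theorem Agrees.kernel_le {q u u' v v' μ θ : ℝ → ℝ} (h : PrincipalPair q u u' v v')
    (hq : LocallyIntegrable q volume) (hq0 : ∀ᵐ x, 0 ≤ q x) (hpos : PositiveTails q)
    (hμ : ∀ x, 0 < μ x) (hθ : ∀ x, 0 < θ x) (hagree : Agrees q μ θ) {m : ℝ}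
    (hm : ∀ x, μ x / θ x * averagingRadius q x ^ 2 ≤ m) :
    ∃ C : ℝ, 0 ≤ C ∧ ∀ x t,
      μ x * green u v x t / θ t ≤
        C * (1 / averagingRadius q x * Real.exp (-(1 / 12) * averagingDist q x t)) ∧
      μ x * green u v x t / θ t ≤
        C * (1 / averagingRadius q t * Real.exp (-(1 / 12) * averagingDist q x t)) := by
  -- Half of the decay rate `1/6` of `green_le` is spent on the weights; the other half remains for
  -- integrability.
  obtain ⟨c, hc1, hc⟩ := hagree (1 / 12) (by norm_num)
  have hd := averagingRadius_pos hq hq0 hpos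
  have hm0 : 0 ≤ m := le_trans
    (by have := hd 0; have := hμ 0; have := hθ 0; positivity) (hm 0)
  refine ⟨3 * c * m, by positivity, fun x t => ?_⟩
  have hG := h.green_le hq hq0 hpos x t
  have hx := hd x
  have ht := hd t
  have hμx := hμ x
  have hμt := hμ t
  have hθx := hθ x
  have hθt := hθ t
  set E := Real.exp (-(1 / 12) * averagingDist q x t) with hE
  have hEE : Real.exp (-(1 / 6) * averagingDist q x t) * Real.exp (1 / 12 * averagingDist q x t)
      = E := by
    rw [hE, ← Real.exp_add]; congr 1; ring
  have hsx : √(averagingRadius q x) ^ 2 = averagingRadius q x := Real.sq_sqrt hx.le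
  have hst : √(averagingRadius q t) ^ 2 = averagingRadius q t := Real.sq_sqrt ht.le
  have hsx0 : 0 < √(averagingRadius q x) := Real.sqrt_pos.2 hx
  have hst0 : 0 < √(averagingRadius q t) := Real.sqrt_pos.2 ht
  rw [Real.sqrt_mul hx.le] at hG
  set a := √(averagingRadius q x)
  set b := √(averagingRadius q t)
  set E6 := Real.exp (-(1 / 6) * averagingDist q x t)
  set E12 := Real.exp (1 / 12 * averagingDist q x t) with hE12
  have hE6 : 0 < E6 := Real.exp_pos _
  constructor
  · have h1 := ((hc t x).2).2
    rw [Real.sqrt_div ht.le, ← hE12] at h1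
    have h2 : b / θ t ≤ c * E12 * (a / θ x) := by
      calc b / θ t = (b / a * (θ x / θ t)) * (a / θ x) := by field_simp
        _ ≤ _ := mul_le_mul_of_nonneg_right h1 (by positivity)
    calc μ x * green u v x t / θ t ≤ μ x * (3 * (a * b) * E6) / θ t := by gcongr
      _ = 3 * μ x * a * E6 * (b / θ t) := by ring
      _ ≤ 3 * μ x * a * E6 * (c * E12 * (a / θ x)) := by gcongr
      _ = 3 * c * (μ x / θ x * averagingRadius q x ^ 2) * (1 / averagingRadius q x * (E6 * E12)) := by
        rw [← hsx]; field_simp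
      _ ≤ 3 * c * m * (1 / averagingRadius q x * E) := by
        rw [hEE]
        have := hm x
        have : 0 < E := Real.exp_pos _
        gcongr
  · have h1 := ((hc x t).1).2
    rw [Real.sqrt_div hx.le, averagingDist_comm, ← hE12] at h1
    have h2 : μ x * a ≤ c * E12 * (μ t * b) := by
      calc μ x * a = (a / b * (μ x / μ t)) * (μ t * b) := by field_simp
        _ ≤ _ := mul_le_mul_of_nonneg_right h1 (by positivity)
    calc μ x * green u v x t / θ t ≤ μ x * (3 * (a * b) * E6) / θ t := by gcongr
      _ = 3 * b / θ t * E6 * (μ x * a) := by ring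
      _ ≤ 3 * b / θ t * E6 * (c * E12 * (μ t * b)) := by gcongr
      _ = 3 * c * (μ t / θ t * averagingRadius q t ^ 2) * (1 / averagingRadius q t * (E6 * E12)) := by
        rw [← hst]; field_simp
      _ ≤ 3 * c * m * (1 / averagingRadius q t * E) := by
        rw [hEE]
        have := hm t
        have : 0 < E := Real.exp_pos _
        gcongr

/-! ### The Schur test -/

theorem integrable_exp_neg_mul_abs {β : ℝ} (hβ : 0 < β) :
    Integrable fun z : ℝ => Real.exp (-β * |z|) := by
  rw [← integrableOn_univ, ← Iic_union_Ioi (a := (0 : ℝ))]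
  refine IntegrableOn.union ?_ ?_
  · refine (integrableOn_exp_mul_Iic hβ 0).congr_fun (fun z hz => ?_) measurableSet_Iic
    simp only [abs_of_nonpos (mem_Iic.1 hz), neg_mul_neg]
  · refine (exp_neg_integrableOn_Ioi 0 hβ).congr_fun (fun z hz => ?_) measurableSet_Ioi
    simp only [abs_of_pos (mem_Ioi.1 hz)]

/-- With `R' = 1/d`, the substitution `z = R(t)` turns the integral into that of `exp(-β |z -
R(x)|)` over the range of `R`; by translation invariance its integral over all of `ℝ` does not
depend on `x`. -/
theorem exists_lintegral_averagingDist_le {q : ℝ → ℝ} (hq : LocallyIntegrable q volume)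
    (hq0 : ∀ᵐ x, 0 ≤ q x) (hpos : PositiveTails q) {β : ℝ} (hβ : 0 < β) :
    ∃ A : ℝ≥0∞, A ≠ ∞ ∧ ∀ x, ∫⁻ t, ENNReal.ofReal
      (1 / averagingRadius q t * Real.exp (-β * averagingDist q x t)) ≤ A := by
  have hd := averagingRadius_pos hq hq0 hpos
  have hc := continuous_one_div_averagingRadius hq hq0 hpos
  set R : ℝ → ℝ := fun t => ∫ ξ in (0 : ℝ)..t, 1 / averagingRadius q ξ with hR
  have hRd : ∀ t, HasDerivAt R (1 / averagingRadius q t) t := fun t =>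
    (hc.integral_hasStrictDerivAt 0 t).hasDerivAt
  have hRm : StrictMono R := strictMono_of_deriv_pos fun t => by
    rw [(hRd t).deriv]; exact one_div_pos.2 (hd t)
  have hdist : ∀ x t, averagingDist q x t = |R t - R x| := fun x t => by
    rw [averagingDist, hR]
    simp only
    rw [intervalIntegral.integral_interval_sub_left (hc.intervalIntegrable _ _)
      (hc.intervalIntegrable _ _)]
  refine ⟨∫⁻ z, ENNReal.ofReal (Real.exp (-β * |z|)), ?_, fun x => ?_⟩
  · have := (integrable_exp_neg_mul_abs hβ).lintegral_lt_top
    exact this.ne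
  · have h1 := lintegral_image_eq_lintegral_abs_deriv_mul MeasurableSet.univ
      (fun t _ => (hRd t).hasDerivWithinAt) hRm.injective.injOn
      (fun z => ENNReal.ofReal (Real.exp (-β * |z - R x|)))
    have h2 : ∫⁻ t, ENNReal.ofReal
        (1 / averagingRadius q t * Real.exp (-β * averagingDist q x t)) =
        ∫⁻ z in R '' univ, ENNReal.ofReal (Real.exp (-β * |z - R x|)) := by
      rw [h1, Measure.restrict_univ]
      refine lintegral_congr fun t => ?_
      have := one_div_pos.2 (hd t)
      rw [ENNReal.ofReal_mul this.le, abs_of_pos this, hdist]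
    rw [h2, ← lintegral_sub_right_eq_self (fun z => ENNReal.ofReal (Real.exp (-β * |z|))) (R x)]
    exact setLIntegral_le_lintegral _ _

/-- Hölder's inequality with respect to a weight. -/
theorem lintegral_mul_rpow_le {α : Type*} [MeasurableSpace α] {ν : Measure α} {k g : α → ℝ≥0∞}
    (hk : AEMeasurable k ν) (hg : AEMeasurable g ν) {r : ℝ} (hr : 1 ≤ r) :
    (∫⁻ t, k t * g t ∂ν) ^ r ≤ (∫⁻ t, k t ∂ν) ^ (r - 1) * ∫⁻ t, k t * g t ^ r ∂ν := by
  rcases hr.eq_or_lt with rfl | hr1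
  · simp
  have hr0 : 0 < r := by linarith
  have hconj := Real.HolderConjugate.conjExponent hr1
  set r' := r.conjExponent with hr'
  have hr'0 : 0 < r' := hconj.symm.pos
  have hsum : 1 / r' + 1 / r = 1 := by
    have := hconj.inv_add_inv_eq_one
    rw [one_div, one_div]; linarith
  -- Split `k g = k^(1/r') · k^(1/r) g`.
  have h1 := ENNReal.lintegral_mul_le_Lp_mul_Lq ν hconj.symm (f := fun t => k t ^ (1 / r'))
    (g := fun t => k t ^ (1 / r) * g t) (hk.pow_const _) ((hk.pow_const _).mul hg)
  have h2 : ∀ t, k t ^ (1 / r') * (k t ^ (1 / r) * g t) = k t * g t := fun t => by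
    rw [← mul_assoc, ← ENNReal.rpow_add_of_nonneg _ _ (by positivity) (by positivity), hsum,
      ENNReal.rpow_one]
  have h3 : ∀ t, (k t ^ (1 / r')) ^ r' = k t := fun t => by
    rw [← ENNReal.rpow_mul, one_div_mul_cancel hr'0.ne', ENNReal.rpow_one]
  have h4 : ∀ t, (k t ^ (1 / r) * g t) ^ r = k t * g t ^ r := fun t => by
    rw [ENNReal.mul_rpow_of_nonneg _ _ hr0.le, ← ENNReal.rpow_mul, one_div_mul_cancel hr0.ne',
      ENNReal.rpow_one]
  simp only [Pi.mul_apply, h2, h3, h4] at h1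
  have h5 := ENNReal.rpow_le_rpow h1 hr0.le
  rw [ENNReal.mul_rpow_of_nonneg _ _ hr0.le, ← ENNReal.rpow_mul, ← ENNReal.rpow_mul,
    one_div_mul_cancel hr0.ne', ENNReal.rpow_one] at h5
  have h6 : 1 / r' * r = r - 1 := by
    have : 1 / r' = 1 - 1 / r := by linarith
    rw [this, sub_mul, one_div_mul_cancel hr0.ne', one_mul]
  rwa [h6] at h5

/-- Weighted Hölder in `t` costs `A^(r-1)` from the rows; Tonelli then leaves a column integral,
which costs one more `A`. -/
theorem schur_test {k : ℝ → ℝ → ℝ≥0∞} (hk : Measurable fun z : ℝ × ℝ => k z.1 z.2)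
    {g : ℝ → ℝ≥0∞} (hg : AEMeasurable g volume) {A : ℝ≥0∞}
    (hrow : ∀ x, ∫⁻ t, k x t ≤ A) (hcol : ∀ t, ∫⁻ x, k x t ≤ A) {r : ℝ} (hr : 1 ≤ r) :
    ∫⁻ x, (∫⁻ t, k x t * g t) ^ r ≤ A ^ r * ∫⁻ t, g t ^ r := by
  have hkx : ∀ x, Measurable (k x) := fun x => hk.comp measurable_prodMk_left
  have hkt : ∀ t, Measurable fun x => k x t := fun t => hk.comp measurable_prodMk_right
  have hr0 : 0 ≤ r - 1 := by linarith
  have hprod : AEMeasurable (Function.uncurry fun x t => A ^ (r - 1) * (k x t * g t ^ r))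
      (volume.prod volume) :=
    ((hk.aemeasurable).mul ((hg.pow_const r).comp_snd)).const_mul _
  calc ∫⁻ x, (∫⁻ t, k x t * g t) ^ r
      ≤ ∫⁻ x, A ^ (r - 1) * ∫⁻ t, k x t * g t ^ r := lintegral_mono fun x =>
        (lintegral_mul_rpow_le (hkx x).aemeasurable hg hr).trans (by gcongr; exact hrow x)
    _ = ∫⁻ x, ∫⁻ t, A ^ (r - 1) * (k x t * g t ^ r) := by
        refine lintegral_congr fun x => ?_
        exact (lintegral_const_mul'' _ ((hkx x).aemeasurable.mul (hg.pow_const r))).symm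
    _ = ∫⁻ t, ∫⁻ x, A ^ (r - 1) * (k x t * g t ^ r) := lintegral_lintegral_swap hprod
    _ ≤ ∫⁻ t, A ^ r * g t ^ r := by
        refine lintegral_mono fun t => ?_
        have h1 : ∫⁻ x, A ^ (r - 1) * (k x t * g t ^ r) =
            A ^ (r - 1) * ((∫⁻ x, k x t) * g t ^ r) := by
          rw [lintegral_const_mul _ ((hkt t).mul_const _), lintegral_mul_const _ (hkt t)]
        rw [h1, ← mul_assoc]
        gcongr
        calc A ^ (r - 1) * ∫⁻ x, k x t ≤ A ^ (r - 1) * A ^ (1 : ℝ) := by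
              rw [ENNReal.rpow_one]; gcongr; exact hcol t
          _ = A ^ r := by
              rw [← ENNReal.rpow_add_of_nonneg _ _ hr0 zero_le_one]; congr 1; ring
    _ = A ^ r * ∫⁻ t, g t ^ r := lintegral_const_mul'' _ (hg.pow_const r)

/-! ### The Green operator -/

/-- `(G f)(x) = ∫ G(x, t) f(t) dt`. -/
noncomputable def greenOp (u v f : ℝ → ℝ) (x : ℝ) : ℝ := ∫ t, green u v x t * f t

namespace PrincipalPair

variable {q u u' v v' f : ℝ → ℝ}

/-- Variation of parameters. -/
theorem solvesWith_of_coeff (h : PrincipalPair q u u' v v') {A B : ℝ → ℝ}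
    (hA : LocallyAC A) (hB : LocallyAC B) (hA' : ∀ᵐ x, HasDerivAt A (v x * f x) x)
    (hB' : ∀ᵐ x, HasDerivAt B (-(u x * f x)) x) :
    SolvesWith q f (fun x => u x * A x + v x * B x) (fun x => u' x * A x + v' x * B x) := by
  have hg : LocallyAC fun x => u' x * A x + v' x * B x :=
    (h.solves_u.locallyAC.mul hA).add (h.solves_v.locallyAC.mul hB)
  -- The terms in `A'` and `B'` cancel only almost everywhere, but what remains is continuous, so
  -- the derivative exists at every point.
  refine ⟨LocallyAC.hasDerivAt_of_continuous
    ((h.solves_u.locallyAC_self.mul hA).add (h.solves_v.locallyAC_self.mul hB)) ?_ hg.continuous,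
    hg, ?_⟩
  · filter_upwards [hA', hB'] with x hAx hBx
    convert! ((h.solves_u.hasDerivAt x).mul hAx).add ((h.solves_v.hasDerivAt x).mul hBx) using 1
    ring
  · filter_upwards [hA', hB', h.solves_u.ae_hasDerivAt, h.solves_v.ae_hasDerivAt]
      with x hAx hBx hux hvx
    convert! (hux.mul hAx).add (hvx.mul hBx) using 1
    simp only [Pi.zero_apply]
    linear_combination f x * h.wronskian x

/-- The ratio `G(x,t)/G(y,t)` is bounded uniformly in `t`, so integrability of `G(y,·) f` at one `y`
passes to all points. When `t` lies between `x` and `y`, monotonicity of `u` and `v` exchanges the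
two factors first. -/
theorem green_le_green (h : PrincipalPair q u u' v v') (x y t : ℝ) :
    green u v x t ≤ (u x / u y + v x / v y) * green u v y t := by
  have hux := h.u_pos x
  have huy := h.u_pos y
  have hvx := h.v_pos x
  have hvy := h.v_pos y
  have hut := h.u_pos t
  have hvt := h.v_pos t
  have hG := h.green_pos y t
  rw [add_mul]
  have h1 : 0 ≤ u x / u y * green u v y t := by positivity
  have h2 : 0 ≤ v x / v y * green u v y t := by positivity
  rcases le_total x t with hxt | hxt <;> rcases le_total y t with hyt | hyt
  · have : green u v x t = v x / v y * green u v y t := by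
      simp only [green, max_eq_right hxt, max_eq_right hyt, min_eq_left hxt, min_eq_left hyt]
      field_simp
    linarith
  · have : green u v x t ≤ u x / u y * green u v y t := by
      simp only [green, max_eq_right hxt, max_eq_left hyt, min_eq_left hxt, min_eq_right hyt]
      calc u t * v x ≤ u x * v t := mul_le_mul (h.antitone_u hxt) (h.monotone_v hxt) hvx.le hux.le
        _ = u x / u y * (u y * v t) := by field_simp
    linarith
  · have : green u v x t ≤ v x / v y * green u v y t := by
      simp only [green, max_eq_left hxt, max_eq_right hyt, min_eq_right hxt, min_eq_left hyt]
      calc u x * v t ≤ u t * v x := mul_le_mul (h.antitone_u hxt) (h.monotone_v hxt) hvt.le hut.le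
        _ = v x / v y * (u t * v y) := by field_simp
    linarith
  · have : green u v x t = u x / u y * green u v y t := by
      simp only [green, max_eq_left hxt, max_eq_left hyt, min_eq_right hxt, min_eq_right hyt]
      field_simp
    linarith

theorem aestronglyMeasurable_green_mul (h : PrincipalPair q u u' v v')
    (hf : AEStronglyMeasurable f volume) (x : ℝ) :
    AEStronglyMeasurable (fun t => green u v x t * f t) volume :=
  (h.continuous_green.comp (Continuous.prodMk_right x)).aestronglyMeasurable.mul hf

theorem integrable_green_mul (h : PrincipalPair q u u' v v')
    (hf : AEStronglyMeasurable f volume) {y : ℝ}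
    (hi : Integrable fun t => green u v y t * f t) (x : ℝ) :
    Integrable fun t => green u v x t * f t := by
  refine (hi.const_mul (u x / u y + v x / v y)).mono (h.aestronglyMeasurable_green_mul hf x)
    (ae_of_all _ fun t => ?_)
  have h1 := h.green_le_green x y t
  have h2 := h.green_pos x t
  rw [← mul_assoc, norm_mul, norm_mul, Real.norm_of_nonneg h2.le,
    Real.norm_of_nonneg (h2.le.trans h1)]
  exact mul_le_mul_of_nonneg_right h1 (norm_nonneg _)

theorem integrableOn_v_mul (h : PrincipalPair q u u' v v') {x : ℝ}
    (hi : Integrable fun t => green u v x t * f t) : IntegrableOn (fun t => v t * f t) (Iic x) := by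
  refine ((hi.const_mul (u x)⁻¹).integrableOn).congr_fun (fun t ht => ?_) measurableSet_Iic
  have := (h.u_pos x).ne'
  simp only [green, max_eq_left (mem_Iic.1 ht), min_eq_right (mem_Iic.1 ht)]
  field_simp

theorem integrableOn_u_mul (h : PrincipalPair q u u' v v') {x : ℝ}
    (hi : Integrable fun t => green u v x t * f t) : IntegrableOn (fun t => u t * f t) (Ioi x) := by
  refine ((hi.const_mul (v x)⁻¹).integrableOn).congr_fun (fun t ht => ?_) measurableSet_Ioi
  have := (h.v_pos x).ne'
  simp only [green, max_eq_right (mem_Ioi.1 ht).le, min_eq_left (mem_Ioi.1 ht).le]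
  field_simp

theorem greenOp_eq {x : ℝ} (hi : Integrable fun t => green u v x t * f t) :
    greenOp u v f x = u x * (∫ t in Iic x, v t * f t) + v x * ∫ t in Ioi x, u t * f t := by
  rw [greenOp, ← intervalIntegral.integral_Iic_add_Ioi (b := x) hi.integrableOn hi.integrableOn,
    ← integral_const_mul, ← integral_const_mul]
  congr 1
  · refine setIntegral_congr_fun measurableSet_Iic fun t ht => ?_
    simp only [green, max_eq_left (mem_Iic.1 ht), min_eq_right (mem_Iic.1 ht)]
    ring
  · refine setIntegral_congr_fun measurableSet_Ioi fun t ht => ?_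
    simp only [green, max_eq_right (mem_Ioi.1 ht).le, min_eq_left (mem_Ioi.1 ht).le]
    ring

/-- Split the integral at `x`. The two tails, rewritten as a constant plus or minus an integral from
0, are the coefficients in variation of parameters. -/
theorem exists_solvesWith_greenOp (h : PrincipalPair q u u' v v')
    (hf : LocallyIntegrable f volume) (hi : ∀ x, Integrable fun t => green u v x t * f t) :
    ∃ g, SolvesWith q f (greenOp u v f) g := by
  have hvf : LocallyIntegrable (fun t => v t * f t) volume := by
    simpa [mul_comm] using hf.smul_continuous h.solves_v.continuous
  have huf : LocallyIntegrable (fun t => u t * f t) volume := by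
    simpa [mul_comm] using hf.smul_continuous h.solves_u.continuous
  have hA : ∀ x, ∫ t in Iic x, v t * f t = (∫ t in Iic 0, v t * f t) +
      ∫ t in (0 : ℝ)..x, v t * f t := fun x => by
    rw [← intervalIntegral.integral_Iic_sub_Iic (h.integrableOn_v_mul (hi 0))
      (h.integrableOn_v_mul (hi x))]
    ring
  have hB : ∀ x, ∫ t in Ioi x, u t * f t = (∫ t in Ioi 0, u t * f t) -
      ∫ t in (0 : ℝ)..x, u t * f t := fun x => by
    rw [← intervalIntegral.integral_Ioi_sub_Ioi' (h.integrableOn_u_mul (hi 0))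
      (h.integrableOn_u_mul (hi x))]
    ring
  have hconst : ∀ c : ℝ, LocallyAC fun _ => c := fun c =>
    LocallyAC.of_hasDerivAt (fun x => hasDerivAt_const x c) continuous_const
  have key := h.solvesWith_of_coeff (f := f)
    (A := fun x => (∫ t in Iic 0, v t * f t) + ∫ t in (0 : ℝ)..x, v t * f t)
    (B := fun x => (∫ t in Ioi 0, u t * f t) - ∫ t in (0 : ℝ)..x, u t * f t)
    ((hconst _).add (LocallyAC.of_integral hvf 0)) ((hconst _).sub (LocallyAC.of_integral huf 0))
    (by
      filter_upwards [_root_.LocallyIntegrable.ae_hasDerivAt_integral hvf] with x hx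
      exact (hx 0).const_add _)
    (by
      filter_upwards [_root_.LocallyIntegrable.ae_hasDerivAt_integral huf] with x hx
      exact (hx 0).const_sub _)
  have heq : greenOp u v f = fun x =>
      u x * ((∫ t in Iic 0, v t * f t) + ∫ t in (0 : ℝ)..x, v t * f t) +
        v x * ((∫ t in Ioi 0, u t * f t) - ∫ t in (0 : ℝ)..x, u t * f t) := by
    funext x
    rw [greenOp_eq (hi x), hA, hB]
  rw [heq]
  exact ⟨_, key⟩

/-- Every solution of the homogeneous equation is a combination of the principal pair. -/
theorem exists_lin_comb (h : PrincipalPair q u u' v v') {y g : ℝ → ℝ} (hy : SolvesWith q 0 y g) :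
    ∃ a b : ℝ, ∀ x, y x = a * u x + b * v x := by
  -- The coefficients are Wronskians, hence constant, and may be evaluated at `x` instead of 0.
  refine ⟨-(g 0 * v 0 - y 0 * v' 0), g 0 * u 0 - y 0 * u' 0, fun x => ?_⟩
  rw [hy.wronskian_eq h.solves_v 0 x, hy.wronskian_eq h.solves_u 0 x]
  linear_combination -y x * h.wronskian x

end PrincipalPair

theorem MemLpLoc.locallyIntegrable {f : ℝ → ℝ} {p : ℝ≥0∞} (hf : MemLpLoc f p) (hp : 1 ≤ p) :
    LocallyIntegrable f volume := by
  refine locallyIntegrable_iff.2 fun K hK => ?_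
  have : IsFiniteMeasure (volume.restrict K) := ⟨by simpa using hK.measure_lt_top⟩
  exact (hf.2 K hK).integrable hp

theorem Continuous.memLpLoc {f : ℝ → ℝ} (hf : Continuous f) (p : ℝ≥0∞) : MemLpLoc f p := by
  refine ⟨hf.aestronglyMeasurable, fun K hK => ?_⟩
  have : IsFiniteMeasure (volume.restrict K) := ⟨by simpa using hK.measure_lt_top⟩
  obtain ⟨C, hC⟩ := hK.exists_bound_of_continuousOn hf.continuousOn
  exact MemLp.of_bound hf.aestronglyMeasurable C
    ((ae_restrict_iff' hK.measurableSet).2 (ae_of_all _ hC))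

/-- The Green operator is bounded from `L_{p,θ}` to `L_{p,μ}`. -/
theorem exists_weightedNorm_greenOp_le {q u u' v v' μ θ : ℝ → ℝ} (h : PrincipalPair q u u' v v')
    (hq : LocallyIntegrable q volume) (hq0 : ∀ᵐ x, 0 ≤ q x) (hpos : PositiveTails q)
    (hμc : Continuous μ) (hμ : ∀ x, 0 < μ x) (hθc : Continuous θ) (hθ : ∀ x, 0 < θ x)
    (hagree : Agrees q μ θ) {m : ℝ} (hm : ∀ x, μ x / θ x * averagingRadius q x ^ 2 ≤ m)
    {p : ℝ≥0∞} (hp : 1 ≤ p) (hp_top : p ≠ ∞) :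
    ∃ B : ℝ≥0∞, B ≠ ∞ ∧ ∀ f, AEStronglyMeasurable f volume →
      weightedNorm μ p (greenOp u v f) ≤ B * weightedNorm θ p f ∧
      (weightedNorm θ p f < ∞ → ∀ x, Integrable fun t => green u v x t * f t) := by
  obtain ⟨C, hC0, hC⟩ := hagree.kernel_le h hq hq0 hpos hμ hθ hm
  obtain ⟨A, hA, hAle⟩ := exists_lintegral_averagingDist_le hq hq0 hpos
    (β := 1 / 12) (by norm_num)
  have hB : ENNReal.ofReal C * A ≠ ∞ := ENNReal.mul_ne_top ENNReal.ofReal_ne_top hA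
  refine ⟨ENNReal.ofReal C * A, hB, fun f hf => ?_⟩
  have hp0 : p ≠ 0 := (one_pos.trans_le hp).ne'
  set r := p.toReal with hr
  have hr1 : 1 ≤ r := by
    rw [hr, ← ENNReal.toReal_one]; exact ENNReal.toReal_mono hp_top hp
  have hr0 : 0 < r := by linarith
  set k : ℝ → ℝ → ℝ≥0∞ := fun x t => ENNReal.ofReal (μ x * green u v x t / θ t) with hk
  have hkm : Measurable fun z : ℝ × ℝ => k z.1 z.2 := by
    refine ENNReal.measurable_ofReal.comp (Continuous.measurable ?_)
    exact ((hμc.comp continuous_fst).mul h.continuous_green).div (hθc.comp continuous_snd)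
      fun z => (hθ z.2).ne'
  have hrow : ∀ x, ∫⁻ t, k x t ≤ ENNReal.ofReal C * A := fun x => by
    calc ∫⁻ t, k x t ≤ ∫⁻ t, ENNReal.ofReal C * ENNReal.ofReal
          (1 / averagingRadius q t * Real.exp (-(1 / 12) * averagingDist q x t)) :=
          lintegral_mono fun t => by
            rw [← ENNReal.ofReal_mul hC0]
            exact ENNReal.ofReal_le_ofReal (hC x t).2
      _ = ENNReal.ofReal C * _ := lintegral_const_mul' _ _ ENNReal.ofReal_ne_top
      _ ≤ _ := by gcongr; exact hAle x
  have hcol : ∀ t, ∫⁻ x, k x t ≤ ENNReal.ofReal C * A := fun t => by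
    calc ∫⁻ x, k x t ≤ ∫⁻ x, ENNReal.ofReal C * ENNReal.ofReal
          (1 / averagingRadius q x * Real.exp (-(1 / 12) * averagingDist q t x)) :=
          lintegral_mono fun x => by
            rw [← ENNReal.ofReal_mul hC0, averagingDist_comm]
            exact ENNReal.ofReal_le_ofReal (hC x t).1
      _ = ENNReal.ofReal C * _ := lintegral_const_mul' _ _ ENNReal.ofReal_ne_top
      _ ≤ _ := by gcongr; exact hAle t
  have hθf : AEStronglyMeasurable (fun t => θ t * f t) volume :=
    hθc.aestronglyMeasurable.mul hf
  have hschur := schur_test hkm hθf.enorm hrow hcol hr1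
  have hpt : ∀ x t, k x t * ‖θ t * f t‖ₑ = ENNReal.ofReal (μ x) * ‖green u v x t * f t‖ₑ := by
    intro x t
    have h1 : 0 ≤ μ x * green u v x t / θ t :=
      div_nonneg (mul_nonneg (hμ x).le (h.green_pos x t).le) (hθ t).le
    have h2 := (hθ t).ne'
    simp only [hk]
    rw [← Real.enorm_of_nonneg h1, ← Real.enorm_of_nonneg (hμ x).le, ← enorm_mul, ← enorm_mul]
    congr 1
    field_simp
  have hint : ∀ x, ∫⁻ t, k x t * ‖θ t * f t‖ₑ =
      ENNReal.ofReal (μ x) * ∫⁻ t, ‖green u v x t * f t‖ₑ := fun x => by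
    simp only [hpt]
    exact lintegral_const_mul' _ _ ENNReal.ofReal_ne_top
  refine ⟨?_, fun hfin => ?_⟩
  · rw [weightedNorm, weightedNorm, eLpNorm_eq_lintegral_rpow_enorm_toReal hp0 hp_top,
      eLpNorm_eq_lintegral_rpow_enorm_toReal hp0 hp_top, ← hr]
    have h1 : ∫⁻ x, ‖μ x * greenOp u v f x‖ₑ ^ r ≤ ∫⁻ x, (∫⁻ t, k x t * ‖θ t * f t‖ₑ) ^ r := by
      refine lintegral_mono fun x => ENNReal.rpow_le_rpow ?_ hr0.le
      rw [hint, enorm_mul, Real.enorm_of_nonneg (hμ x).le]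
      gcongr
      exact enorm_integral_le_lintegral_enorm _
    calc _ ≤ _ := ENNReal.rpow_le_rpow (h1.trans hschur) (by positivity : 0 ≤ 1 / r)
      _ = _ := by
        rw [ENNReal.mul_rpow_of_nonneg _ _ (by positivity), ← ENNReal.rpow_mul,
          mul_one_div_cancel hr0.ne', ENNReal.rpow_one]
  · have h1 : ∫⁻ t, ‖θ t * f t‖ₑ ^ r < ∞ := by
      rw [weightedNorm, eLpNorm_eq_lintegral_rpow_enorm_toReal hp0 hp_top, ← hr] at hfin
      by_contra! htop
      rw [top_le_iff.1 htop, ENNReal.top_rpow_of_pos (by positivity)] at hfin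
      exact lt_irrefl _ hfin
    have h2 : ∫⁻ x, (∫⁻ t, k x t * ‖θ t * f t‖ₑ) ^ r < ∞ :=
      hschur.trans_lt (ENNReal.mul_lt_top (ENNReal.rpow_lt_top_of_nonneg hr0.le hB) h1)
    -- Finiteness of the outer integral gives absolute convergence at some point, and one point
    -- suffices by `green_le_green`.
    obtain ⟨x₀, hx₀⟩ : ∃ x₀, ∫⁻ t, k x₀ t * ‖θ t * f t‖ₑ < ∞ := by
      by_contra! hcon
      have : ∀ x, (∫⁻ t, k x t * ‖θ t * f t‖ₑ) ^ r = ∞ := fun x => by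
        rw [top_le_iff.1 (hcon x), ENNReal.top_rpow_of_pos hr0]
      simp only [this, lintegral_const, Real.volume_univ] at h2
      exact absurd h2 (by simp)
    rw [hint] at hx₀
    have h3 : ∫⁻ t, ‖green u v x₀ t * f t‖ₑ < ∞ := by
      by_contra! htop
      rw [top_le_iff.1 htop, ENNReal.mul_top (by simpa using hμ x₀)] at hx₀
      exact lt_irrefl _ hx₀
    exact h.integrable_green_mul hf ⟨h.aestronglyMeasurable_green_mul hf x₀, h3⟩

/-! ### Growth of the nonprincipal solution and uniqueness -/

theorem memLp_inv_Ioi {p : ℝ≥0∞} (hp : 1 < p) {T : ℝ} (hT : 0 < T) :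
    MemLp (fun t : ℝ => t⁻¹) p (volume.restrict (Ioi T)) := by
  have hm : AEStronglyMeasurable (fun t : ℝ => t⁻¹) (volume.restrict (Ioi T)) :=
    measurable_inv.aestronglyMeasurable
  by_cases htop : p = ∞
  · subst htop
    refine memLp_top_of_bound hm T⁻¹ ((ae_restrict_iff' measurableSet_Ioi).2 (ae_of_all _ ?_))
    intro t ht
    have ht0 : 0 < t := hT.trans ht
    rw [Real.norm_of_nonneg (by positivity)]
    exact inv_anti₀ hT (le_of_lt ht)
  · refine (integrable_norm_rpow_iff hm (one_pos.trans hp).ne' htop).1 ?_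
    have h1 : 1 < p.toReal := by
      rw [← ENNReal.toReal_one]; exact (ENNReal.toReal_lt_toReal ENNReal.one_ne_top htop).2 hp
    refine (integrableOn_Ioi_rpow_of_lt (a := -p.toReal) (by linarith) hT).congr_fun
      (fun t ht => ?_) measurableSet_Ioi
    have ht0 : 0 < t := hT.trans ht
    simp only
    rw [Real.norm_of_nonneg (by positivity), Real.inv_rpow ht0.le, Real.rpow_neg ht0.le]

/-- A combination of a bounded function and a function of at least linear growth lies in `L_{p,μ}`
near `+∞` only if the second coefficient vanishes. -/
theorem coeff_eq_zero_of_weightedNorm_lt_top {μ U V y : ℝ → ℝ} {a b C κ T : ℝ} {p : ℝ≥0∞}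
    (hp : 1 ≤ p) (hp_top : p ≠ ∞) (hμc : Continuous μ) (hμ : ∀ x, 0 < μ x)
    (hdiv : ∫⁻ t in Ici (0 : ℝ), ENNReal.ofReal (μ t) = ∞)
    (hU : ∀ t, T ≤ t → |U t| ≤ C) (hκ : 0 < κ) (hV : ∀ t, T ≤ t → κ * (t - T) ≤ V t)
    (hy : ∀ t, T ≤ t → y t = a * U t + b * V t) (hym : AEStronglyMeasurable y volume)
    (hfin : weightedNorm μ p y < ∞) : b = 0 := by
  by_contra hb
  have hb0 : 0 < |b| := abs_pos.2 hb
  set c := |b| * κ / 2 with hc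
  have hc0 : 0 < c := by positivity
  have hC0 : 0 ≤ C := (abs_nonneg _).trans (hU T le_rfl)
  -- Beyond `S`, half of the slope `|b| κ` absorbs the shift by `T` and the bounded term, leaving
  -- `|y t| ≥ c t`.
  set S := max (max 1 T) ((|b| * κ * |T| + |a| * C) / c) with hS
  have hS1 : 1 ≤ S := (le_max_left _ _).trans (le_max_left _ _)
  have hST : T ≤ S := (le_max_right _ _).trans (le_max_left _ _)
  have hlow : ∀ t, S ≤ t → c * t ≤ |y t| := by
    intro t ht
    have h1 := hV t (hST.trans ht)
    have h2 := hU t (hST.trans ht)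
    have h3 : |b| * κ * |T| + |a| * C ≤ c * t := by
      rw [mul_comm c, ← div_le_iff₀ hc0]; exact (le_max_right _ _).trans ht
    have h4 : |b| * V t ≤ |y t| + |a| * C := by
      have h5 : b * V t = y t - a * U t := by rw [hy t (hST.trans ht)]; ring
      have h6 : |b * V t| ≤ |y t| + |a * U t| := by rw [h5]; exact abs_sub _ _
      rw [abs_mul, abs_mul] at h6
      have h7 := mul_le_mul_of_nonneg_left h2 (abs_nonneg a)
      have h8 := mul_le_mul_of_nonneg_left (le_abs_self (V t)) hb0.le
      linarith
    have h5 := mul_le_mul_of_nonneg_left h1 hb0.le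
    have h6 := mul_le_mul_of_nonneg_left (le_abs_self T) (by positivity : 0 ≤ |b| * κ)
    have h7 : |b| * κ = 2 * c := by rw [hc]; ring
    have h8 : |b| * (κ * (t - T)) = 2 * c * t - |b| * κ * T := by rw [← h7]; ring
    linarith
  have hLp : MemLp (fun t => μ t * y t) p (volume.restrict (Ioi S)) :=
    MemLp.restrict _ ⟨hμc.aestronglyMeasurable.mul hym, hfin⟩
  have hconj := ENNReal.HolderConjugate.conjExponent hp
  -- Here `p < ∞` is essential: it makes the dual exponent exceed 1 (it is `∞` for `p = 1`), so
  -- `1/t` lies in the dual space near `+∞`.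
  have hp' : 1 < p.conjExponent := by
    rw [ENNReal.conjExponent]
    refine ENNReal.lt_add_right ENNReal.one_ne_top ?_
    exact ENNReal.inv_ne_zero.2 (ENNReal.sub_ne_top hp_top)
  have hS0 : 0 < S := by linarith
  have hprod := (hLp.integrable_mul (memLp_inv_Ioi hp' hS0)).const_mul c⁻¹
  have hμi : IntegrableOn μ (Ioi S) := by
    refine hprod.mono hμc.aestronglyMeasurable
      ((ae_restrict_iff' measurableSet_Ioi).2 (ae_of_all _ fun t ht => ?_))
    have ht0 : 0 < t := hS0.trans ht
    have h1 := hlow t (le_of_lt ht)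
    have hμt := hμ t
    simp only [Pi.mul_apply, norm_mul, norm_inv, Real.norm_eq_abs, abs_of_pos hμt,
      abs_of_pos hc0, abs_of_pos ht0]
    calc μ t = c⁻¹ * (μ t * (c * t) * t⁻¹) := by field_simp
      _ ≤ c⁻¹ * (μ t * |y t| * t⁻¹) := by gcongr
  have hμi2 : IntegrableOn μ (Ici 0) := by
    have h1 : IntegrableOn μ (Icc 0 S) := hμc.continuousOn.integrableOn_Icc
    rw [← Icc_union_Ioi_eq_Ici hS0.le]
    exact h1.union hμi
  have := hμi2.lintegral_lt_top
  rw [hdiv] at this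
  exact lt_irrefl _ this

namespace PrincipalPair

variable {q u u' v v' : ℝ → ℝ}

/-- `v'` becomes positive once `q` has had positive mass, and from there `v` stays above a tangent
line of positive slope. -/
theorem exists_linear_growth_v (h : PrincipalPair q u u' v v') (hq : LocallyIntegrable q volume)
    (hq0 : ∀ᵐ x, 0 ≤ q x) (hpos : PositiveTails q) :
    ∃ κ T : ℝ, 0 < κ ∧ ∀ S, T ≤ S → ∀ t, S ≤ t → κ * (t - S) ≤ v t := by
  obtain ⟨b, hb, hqb⟩ := hpos.exists_right hq hq0 0
  have h1 := h.solves_v.sub_eq_integral 0 b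
  have h2 : ∫ x in (0 : ℝ)..b, v 0 * q x ≤ ∫ x in (0 : ℝ)..b, q x * v x := by
    refine integral_mono_on_ae hb.le
      ((intervalIntegrable_of_locallyIntegrable hq _ _).const_mul _)
      ((intervalIntegrable_of_locallyIntegrable hq _ _).mul_continuousOn
        h.solves_v.continuous.continuousOn) ?_
    filter_upwards [hq0] with x hx hmem
    rw [mul_comm]
    exact mul_le_mul_of_nonneg_left (h.monotone_v hmem.1) hx
  rw [intervalIntegral.integral_const_mul] at h2
  have h3 := mul_pos (h.v_pos 0) hqb
  have h4 : 0 < v' b := by linarith [h.v'_nonneg 0]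
  refine ⟨v' b, b, h4, fun S hS t ht => ?_⟩
  have h5 := h.solves_v.tangent_le hq0 h.v_pos b t
  have h6 := h.v_pos b
  have h7 : v' b * (t - S) ≤ v' b * (t - b) := mul_le_mul_of_nonneg_left (by linarith) h4.le
  linarith

theorem exists_linear_growth_u (h : PrincipalPair q u u' v v') (hq : LocallyIntegrable q volume)
    (hq0 : ∀ᵐ x, 0 ≤ q x) (hpos : PositiveTails q) :
    ∃ κ T : ℝ, 0 < κ ∧ ∀ S, T ≤ S → ∀ t, S ≤ t → κ * (t - S) ≤ u (-t) := by
  obtain ⟨b, hb, hqb⟩ := hpos.exists_left hq hq0 0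
  have h1 := h.solves_u.sub_eq_integral b 0
  have h2 : ∫ x in b..(0 : ℝ), u 0 * q x ≤ ∫ x in b..(0 : ℝ), q x * u x := by
    refine integral_mono_on_ae hb.le
      ((intervalIntegrable_of_locallyIntegrable hq _ _).const_mul _)
      ((intervalIntegrable_of_locallyIntegrable hq _ _).mul_continuousOn
        h.solves_u.continuous.continuousOn) ?_
    filter_upwards [hq0] with x hx hmem
    rw [mul_comm]
    exact mul_le_mul_of_nonneg_left (h.antitone_u hmem.2) hx
  rw [intervalIntegral.integral_const_mul] at h2
  have h3 := mul_pos (h.u_pos 0) hqb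
  have h4 : 0 < -u' b := by linarith [h.u'_nonpos 0]
  refine ⟨-u' b, -b, h4, fun S hS t ht => ?_⟩
  have h5 := h.solves_u.tangent_le hq0 h.u_pos b (-t)
  have h6 := h.u_pos b
  have h7 : -u' b * (t - S) ≤ -u' b * (t + b) := mul_le_mul_of_nonneg_left (by linarith) h4.le
  linarith

/-- The representation is needed only on a half-line, so this also covers solutions with a compactly
supported right-hand side. -/
theorem coeff_v_eq_zero (h : PrincipalPair q u u' v v') (hq : LocallyIntegrable q volume)
    (hq0 : ∀ᵐ x, 0 ≤ q x) (hpos : PositiveTails q) {μ y : ℝ → ℝ} {a b S : ℝ} {p : ℝ≥0∞}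
    (hp : 1 ≤ p) (hp_top : p ≠ ∞) (hμc : Continuous μ) (hμ : ∀ x, 0 < μ x)
    (hdiv : DivergentTails μ) (hy : ∀ t, S ≤ t → y t = a * u t + b * v t)
    (hym : AEStronglyMeasurable y volume) (hfin : weightedNorm μ p y < ∞) : b = 0 := by
  obtain ⟨κ, T, hκ, hT⟩ := h.exists_linear_growth_v hq hq0 hpos
  refine coeff_eq_zero_of_weightedNorm_lt_top (T := max S T) (C := u (max S T)) (U := u) (V := v)
    hp hp_top hμc hμ hdiv.2 (fun t ht => ?_) hκ (hT _ (le_max_right _ _))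
    (fun t ht => hy t ((le_max_left _ _).trans ht)) hym hfin
  rw [abs_of_pos (h.u_pos t)]
  exact h.antitone_u ht

/-- The reflection `t ↦ -t` carries this end to `+∞` and exchanges the roles of `u` and `v`. -/
theorem coeff_u_eq_zero (h : PrincipalPair q u u' v v') (hq : LocallyIntegrable q volume)
    (hq0 : ∀ᵐ x, 0 ≤ q x) (hpos : PositiveTails q) {μ y : ℝ → ℝ} {a b S : ℝ} {p : ℝ≥0∞}
    (hp : 1 ≤ p) (hp_top : p ≠ ∞) (hμc : Continuous μ) (hμ : ∀ x, 0 < μ x)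
    (hdiv : DivergentTails μ) (hy : ∀ t, t ≤ S → y t = a * u t + b * v t)
    (hym : AEStronglyMeasurable y volume) (hfin : weightedNorm μ p y < ∞) : a = 0 := by
  obtain ⟨κ, T, hκ, hT⟩ := h.exists_linear_growth_u hq hq0 hpos
  have hneg := Measure.measurePreserving_neg (volume : Measure ℝ)
  refine coeff_eq_zero_of_weightedNorm_lt_top (μ := fun t => μ (-t)) (y := fun t => y (-t))
    (T := max (-S) T) (C := v (-max (-S) T)) (a := b) (U := fun t => v (-t)) (V := fun t => u (-t))
    hp hp_top (hμc.comp continuous_neg) (fun x => hμ (-x)) ?_ (fun t ht => ?_) hκ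
    (hT _ (le_max_right _ _))
    (fun t ht => ?_) (hym.comp_measurePreserving hneg) ?_
  · rw [← hdiv.1, ← hneg.setLIntegral_comp_preimage measurableSet_Iic (by fun_prop)]
    simp
  · rw [abs_of_pos (h.v_pos _)]
    exact h.monotone_v (neg_le_neg ht)
  · rw [hy (-t) (by linarith [(le_max_left _ _).trans ht])]
    ring
  · have := eLpNorm_comp_measurePreserving (p := p)
      (hμc.aestronglyMeasurable.mul hym : AEStronglyMeasurable (fun x => μ x * y x) volume) hneg
    exact this.trans_lt hfin

end PrincipalPair

/-! ### Uniqueness in `L_{p,μ}` and sufficiency. -/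

namespace PrincipalPair

variable {q u u' v v' μ θ : ℝ → ℝ}

/-- Solutions in `L_{p,μ}` are unique. -/
theorem solution_unique (h : PrincipalPair q u u' v v') (hq : LocallyIntegrable q volume)
    (hq0 : ∀ᵐ x, 0 ≤ q x) (hpos : PositiveTails q) {p : ℝ≥0∞} (hp : 1 ≤ p) (hp_top : p ≠ ∞)
    (hμc : Continuous μ) (hμ : ∀ x, 0 < μ x) (hdiv : DivergentTails μ) {f y₁ y₂ g₁ g₂ : ℝ → ℝ}
    (h₁ : SolvesWith q f y₁ g₁) (h₂ : SolvesWith q f y₂ g₂) (hy₁ : weightedNorm μ p y₁ < ∞)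
    (hy₂ : weightedNorm μ p y₂ < ∞) : y₁ = y₂ := by
  have hd : SolvesWith q 0 (fun x => y₁ x - y₂ x) (fun x => g₁ x - g₂ x) := by
    convert! h₁.lin_comb h₂ 1 (-1) using 1
    all_goals funext x; simp <;> ring
  have hfin : weightedNorm μ p (fun x => y₁ x - y₂ x) < ∞ := by
    have := eLpNorm_sub_le (p := p) (hμc.mul h₁.continuous).aestronglyMeasurable
      (hμc.mul h₂.continuous).aestronglyMeasurable (μ := volume) hp
    refine lt_of_le_of_lt (le_of_eq_of_le ?_ this) (ENNReal.add_lt_top.2 ⟨hy₁, hy₂⟩)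
    rw [weightedNorm]
    congr 1
    funext x
    simp [mul_sub]
  obtain ⟨a, b, hab⟩ := h.exists_lin_comb hd
  have hm := hd.continuous.aestronglyMeasurable (μ := volume)
  have hb := h.coeff_v_eq_zero hq hq0 hpos (S := 0) hp hp_top hμc hμ hdiv (fun t _ => hab t) hm hfin
  have ha := h.coeff_u_eq_zero hq hq0 hpos (S := 0) hp hp_top hμc hμ hdiv (fun t _ => hab t) hm hfin
  funext x
  have := hab x
  rw [ha, hb] at this
  linarith

theorem isAdmissible (h : PrincipalPair q u u' v v') (hq : LocallyIntegrable q volume)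
    (hq0 : ∀ᵐ x, 0 ≤ q x) (hpos : PositiveTails q) {p : ℝ≥0∞} (hp : 1 ≤ p) (hp_top : p ≠ ∞)
    (hμc : Continuous μ) (hμ : ∀ x, 0 < μ x) (hθc : Continuous θ) (hθ : ∀ x, 0 < θ x)
    (hdiv : DivergentTails μ) (hagree : Agrees q μ θ) (hsup : weightSup q μ θ < ∞) :
    IsAdmissible q μ θ p := by
  have hm : ∀ x, μ x / θ x * averagingRadius q x ^ 2 ≤ (weightSup q μ θ).toReal := fun x =>
    (ENNReal.ofReal_le_iff_le_toReal hsup.ne).1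
      (le_iSup (fun x => ENNReal.ofReal (μ x / θ x * averagingRadius q x ^ 2)) x)
  obtain ⟨B, hB, hBle⟩ := exists_weightedNorm_greenOp_le h hq hq0 hpos hμc hμ hθc hθ hagree hm
    hp hp_top
  have hsol : ∀ f, MemWeightedLp θ p f → (∃ g, SolvesWith q f (greenOp u v f) g) ∧
      MemWeightedLp μ p (greenOp u v f) := fun f hf => by
    obtain ⟨hle, hi⟩ := hBle f hf.1.1
    obtain ⟨g, hg⟩ := h.exists_solvesWith_greenOp (hf.1.locallyIntegrable hp) (hi hf.2)
    exact ⟨⟨g, hg⟩, Continuous.memLpLoc hg.continuous p,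
      hle.trans_lt (ENNReal.mul_lt_top hB.lt_top hf.2)⟩
  have huniq : ∀ f y, MemWeightedLp θ p f → IsSolution q f y → MemWeightedLp μ p y →
      y = greenOp u v f := fun f y hf hy hyμ => by
    obtain ⟨⟨g, hg⟩, hgμ⟩ := hsol f hf
    exact h.solution_unique hq hq0 hpos hp hp_top hμc hμ hdiv hy.solvesWith hg hyμ.2 hgμ.2
  -- The added 1 keeps the constant positive should `B` be 0.
  refine ⟨fun f hf => ?_, B.toReal + 1, by positivity, fun f y hf hy hyμ => ?_⟩
  · obtain ⟨⟨g, hg⟩, hgμ⟩ := hsol f hf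
    exact ⟨_, ⟨hg.isSolution, hgμ⟩, fun y hy => huniq f y hf hy.1 hy.2⟩
  · rw [huniq f y hf hy hyμ]
    refine (hBle f hf.1.1).1.trans ?_
    gcongr
    rw [← ENNReal.ofReal_toReal hB]
    exact ENNReal.ofReal_le_ofReal (by rw [ENNReal.toReal_ofReal (by positivity)]; linarith)

end PrincipalPair

/-! ### Local comparison on an averaging window -/

section Window

variable {q μ θ : ℝ → ℝ} {x ξ t : ℝ}

theorem half_averagingRadius_le (hq : LocallyIntegrable q volume) (hq0 : ∀ᵐ x, 0 ≤ q x)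
    (hpos : PositiveTails q) (hξ : |ξ - x| ≤ averagingRadius q x / 2) :
    averagingRadius q x / 2 ≤ averagingRadius q ξ := by
  have h1 := averagingRadius_le_add hq hq0 hpos ξ x
  have h2 : 1 ≤ √2 := by rw [Real.one_le_sqrt]; norm_num
  have h3 := averagingRadius_pos hq hq0 hpos x
  have h4 : √2 * (averagingRadius q x / 2) ≤ √2 * averagingRadius q ξ := by nlinarith
  exact le_of_mul_le_mul_left h4 (by positivity)

theorem averagingRadius_le_two_mul (hq : LocallyIntegrable q volume) (hq0 : ∀ᵐ x, 0 ≤ q x)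
    (hpos : PositiveTails q) (hξ : |ξ - x| ≤ averagingRadius q x / 2) :
    averagingRadius q ξ ≤ 2 * averagingRadius q x := by
  have h1 := averagingRadius_le_add hq hq0 hpos x ξ
  rw [abs_sub_comm] at h1
  have h2 : 1 ≤ √2 := by rw [Real.one_le_sqrt]; norm_num
  have h3 := averagingRadius_pos hq hq0 hpos x
  have h4 : √2 * averagingRadius q ξ ≤ √2 * (2 * averagingRadius q x) := by nlinarith
  exact le_of_mul_le_mul_left h4 (by positivity)

/-- Between the points the integrand is at most `2/d(x)`, over a length at most `d(x)`. -/
theorem averagingDist_le_two (hq : LocallyIntegrable q volume) (hq0 : ∀ᵐ x, 0 ≤ q x)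
    (hpos : PositiveTails q) (hξ : |ξ - x| ≤ averagingRadius q x / 2)
    (ht : |t - x| ≤ averagingRadius q x / 2) : averagingDist q ξ t ≤ 2 := by
  have hd := averagingRadius_pos hq hq0 hpos
  have h1 : ∀ s ∈ uIoc ξ t, ‖1 / averagingRadius q s‖ ≤ 2 / averagingRadius q x := by
    intro s hs
    have h2 := uIoc_subset_uIcc hs
    have h3 : |s - x| ≤ averagingRadius q x / 2 := by
      rw [abs_le] at hξ ht ⊢
      rcases le_total ξ t with hle | hle
      · rw [uIcc_of_le hle] at h2
        constructor <;> linarith [h2.1, h2.2]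
      · rw [uIcc_of_ge hle] at h2
        constructor <;> linarith [h2.1, h2.2]
    rw [Real.norm_of_nonneg (one_div_pos.2 (hd s)).le, div_le_div_iff₀ (hd s) (hd x)]
    linarith [half_averagingRadius_le hq hq0 hpos h3]
  have h2 := intervalIntegral.norm_integral_le_of_norm_le_const h1
  have h3 : |t - ξ| ≤ averagingRadius q x := by
    rw [abs_le] at hξ ht ⊢
    constructor <;> linarith
  calc averagingDist q ξ t ≤ 2 / averagingRadius q x * |t - ξ| := h2
    _ ≤ 2 / averagingRadius q x * averagingRadius q x := by have := hd x; gcongr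
    _ = 2 := div_mul_cancel₀ _ (hd x).ne'

/-- On the window the distance is at most 2 and the ratio of radii at most 2, so the lower bounds in
the agreement condition, with `ε = 1`, lose only a constant factor. -/
theorem Agrees.exists_local_comparison (hq : LocallyIntegrable q volume) (hq0 : ∀ᵐ x, 0 ≤ q x)
    (hpos : PositiveTails q) (hμ : ∀ x, 0 < μ x) (hθ : ∀ x, 0 < θ x) (hagree : Agrees q μ θ) :
    ∃ k : ℝ, 0 < k ∧ ∀ x ξ, |ξ - x| ≤ averagingRadius q x / 2 →
      k * μ x ≤ μ ξ ∧ θ ξ ≤ θ x / k := by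
  obtain ⟨c, hc1, hc⟩ := hagree 1 one_pos
  have hc0 : 0 < c := by linarith
  refine ⟨c⁻¹ * Real.exp (-2) / 2, by positivity, fun x ξ hξ => ?_⟩
  have hd := averagingRadius_pos hq hq0 hpos
  have h1 := averagingRadius_le_two_mul hq hq0 hpos hξ
  have h2 : averagingDist q x ξ ≤ 2 :=
    averagingDist_le_two hq hq0 hpos (by simpa using (half_pos (hd x)).le) hξ
  have h3 : √(averagingRadius q ξ / averagingRadius q x) ≤ 2 := by
    rw [Real.sqrt_le_left (by norm_num), div_le_iff₀ (hd x)]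
    linarith [hd x]
  have h4 : c⁻¹ * Real.exp (-2) ≤ c⁻¹ * Real.exp (-1 * averagingDist q x ξ) := by
    gcongr
    linarith
  have hμx := hμ x
  have hμξ := hμ ξ
  have hθx := hθ x
  have hθξ := hθ ξ
  have h5 := h4.trans (hc ξ x).1.1
  have h6 := h4.trans (hc ξ x).2.1
  have h7 : c⁻¹ * Real.exp (-2) ≤ 2 * (μ ξ / μ x) := h5.trans (by gcongr)
  have h8 : c⁻¹ * Real.exp (-2) ≤ 2 * (θ x / θ ξ) := h6.trans (by gcongr)
  constructor
  · rw [← le_div_iff₀ hμx]; linarith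
  · rw [le_div_iff₀ (by positivity), mul_comm, ← le_div_iff₀ hθξ]; linarith

end Window

/-! ### Necessity, by testing on windows. -/

namespace PrincipalPair

variable {q u u' v v' μ θ : ℝ → ℝ}

/-- For both points in the window, `le_green` bounds Green's function below by a constant times
`d(x)`; the length of the window supplies the second factor `d(x)`. The exponent is `12 · 2`, from
distance at most 2. -/
theorem le_greenOp_indicator (h : PrincipalPair q u u' v v') (hq : LocallyIntegrable q volume)
    (hq0 : ∀ᵐ x, 0 ≤ q x) (hpos : PositiveTails q) {x ξ : ℝ}
    (hξ : |ξ - x| ≤ averagingRadius q x / 2) :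
    Real.exp (-24) / 48 * averagingRadius q x ^ 2 ≤ greenOp u v
      ((Icc (x - averagingRadius q x / 2) (x + averagingRadius q x / 2)).indicator fun _ => 1) ξ := by
  have hd := averagingRadius_pos hq hq0 hpos
  set I := Icc (x - averagingRadius q x / 2) (x + averagingRadius q x / 2) with hI
  have hdx := hd x
  have hlow : ∀ t ∈ I, Real.exp (-24) / 48 * averagingRadius q x ≤ green u v ξ t := by
    intro t ht
    have ht' : |t - x| ≤ averagingRadius q x / 2 := by
      rw [abs_le]; constructor <;> linarith [ht.1, ht.2]
    have h1 := half_averagingRadius_le hq hq0 hpos hξ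
    have h2 := half_averagingRadius_le hq hq0 hpos ht'
    have h3 := averagingDist_le_two hq hq0 hpos hξ ht'
    have h4 : averagingRadius q x / 2 ≤ √(averagingRadius q ξ * averagingRadius q t) := by
      rw [Real.le_sqrt' (by positivity), sq]
      exact mul_le_mul h1 h2 (by positivity) (hd ξ).le
    calc Real.exp (-24) / 48 * averagingRadius q x
        = 1 / 24 * (averagingRadius q x / 2) * Real.exp (-24) := by ring
      _ ≤ 1 / 24 * √(averagingRadius q ξ * averagingRadius q t) *
          Real.exp (-12 * averagingDist q ξ t) := by
            gcongr
            linarith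
      _ ≤ _ := h.le_green hq hq0 hpos ξ t
  have hc : Continuous fun t => green u v ξ t := h.continuous_green.comp (Continuous.prodMk_right ξ)
  have heq : greenOp u v (I.indicator fun _ => 1) ξ = ∫ t in I, green u v ξ t := by
    rw [greenOp, ← integral_indicator measurableSet_Icc]
    congr 1
    funext t
    by_cases ht : t ∈ I
    · rw [indicator_of_mem ht, indicator_of_mem ht, mul_one]
    · rw [indicator_of_notMem ht, indicator_of_notMem ht, mul_zero]
  have hvol : volume.real I = averagingRadius q x := by
    rw [hI, Real.volume_real_Icc_of_le (by linarith)]; ring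
  have h1 := setIntegral_mono_on (μ := volume) (integrableOn_const (s := I) (by simp [hI]))
    (hc.continuousOn.integrableOn_Icc) measurableSet_Icc hlow
  rw [setIntegral_const, hvol, smul_eq_mul] at h1
  rw [heq]
  calc _ = averagingRadius q x * (Real.exp (-24) / 48 * averagingRadius q x) := by ring
    _ ≤ _ := h1

/-- For a bounded right-hand side supported in `[a, b]`, a solution in `L_{p,μ}` is given by the
Green operator. -/
theorem eq_greenOp_indicator (h : PrincipalPair q u u' v v') (hq : LocallyIntegrable q volume)
    (hq0 : ∀ᵐ x, 0 ≤ q x) (hpos : PositiveTails q) {p : ℝ≥0∞} (hp : 1 ≤ p) (hp_top : p ≠ ∞)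
    (hμc : Continuous μ) (hμ : ∀ x, 0 < μ x) (hdiv : DivergentTails μ) {a b : ℝ} {y : ℝ → ℝ}
    (hy : IsSolution q ((Icc a b).indicator fun _ => 1) y) (hfin : weightedNorm μ p y < ∞) :
    y = greenOp u v ((Icc a b).indicator fun _ => 1) := by
  set f : ℝ → ℝ := (Icc a b).indicator fun _ => 1 with hf
  have hfi : Integrable f := by
    rw [hf, integrable_indicator_iff measurableSet_Icc]
    exact integrableOn_const (by simp)
  have hi : ∀ x, Integrable fun t => green u v x t * f t := fun x => by
    have hc : Continuous fun t => green u v x t :=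
      h.continuous_green.comp (Continuous.prodMk_right x)
    have : (fun t => green u v x t * f t) = (Icc a b).indicator fun t => green u v x t := by
      funext t
      by_cases ht : t ∈ Icc a b <;> simp [hf, ht]
    rw [this, integrable_indicator_iff measurableSet_Icc]
    exact hc.continuousOn.integrableOn_Icc
  obtain ⟨g, hg⟩ := h.exists_solvesWith_greenOp hfi.locallyIntegrable hi
  have hd : SolvesWith q 0 (fun x => y x - greenOp u v f x) (fun x => deriv y x - g x) := by
    convert! hy.solvesWith.lin_comb hg 1 (-1) using 1
    all_goals funext x; simp <;> ring
  obtain ⟨A, B, hAB⟩ := h.exists_lin_comb hd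
  have hm := hy.solvesWith.continuous.aestronglyMeasurable (μ := volume)
  -- Outside the support the potential is a multiple of the solution bounded at that end. The
  -- coefficient test can thus be applied to `y` itself, without knowing that the potential lies in
  -- `L_{p,μ}`.
  have hright : ∀ t, b ≤ t → greenOp u v f t = (∫ s, v s * f s) * u t := fun t ht => by
    rw [greenOp, mul_comm, ← integral_const_mul]
    congr 1
    funext s
    by_cases hs : s ∈ Icc a b
    · simp only [green, max_eq_left (hs.2.trans ht), min_eq_right (hs.2.trans ht)]
      ring
    · simp [hf, hs]
  have hleft : ∀ t, t ≤ a → greenOp u v f t = (∫ s, u s * f s) * v t := fun t ht => by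
    rw [greenOp, mul_comm, ← integral_const_mul]
    congr 1
    funext s
    by_cases hs : s ∈ Icc a b
    · simp only [green, max_eq_right (ht.trans hs.1), min_eq_left (ht.trans hs.1)]
      ring
    · simp [hf, hs]
  have hB := h.coeff_v_eq_zero hq hq0 hpos (S := b) (a := A + ∫ s, v s * f s) (b := B) hp hp_top
    hμc hμ hdiv (fun t ht => by have := hAB t; rw [hright t ht] at this; linarith) hm hfin
  have hA := h.coeff_u_eq_zero hq hq0 hpos (S := a) (a := A) (b := B + ∫ s, u s * f s) hp hp_top
    hμc hμ hdiv (fun t ht => by have := hAB t; rw [hleft t ht] at this; linarith) hm hfin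
  funext x
  have := hAB x
  rw [hA, hB] at this
  linarith

theorem weightSup_lt_top (h : PrincipalPair q u u' v v') (hq : LocallyIntegrable q volume)
    (hq0 : ∀ᵐ x, 0 ≤ q x) (hpos : PositiveTails q) {p : ℝ≥0∞} (hp : 1 ≤ p) (hp_top : p ≠ ∞)
    (hμc : Continuous μ) (hμ : ∀ x, 0 < μ x) (hθ : ∀ x, 0 < θ x)
    (hdiv : DivergentTails μ) (hagree : Agrees q μ θ) (hadm : IsAdmissible q μ θ p) :
    weightSup q μ θ < ∞ := by
  obtain ⟨k, hk0, hk⟩ := hagree.exists_local_comparison hq hq0 hpos hμ hθ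
  obtain ⟨hex, c, hc0, hc⟩ := hadm
  set K : ℝ := Real.exp (-24) / 48 with hK
  have hK0 : 0 < K := by positivity
  have hp0 : p ≠ 0 := (one_pos.trans_le hp).ne'
  -- The bound comes from `k μ(x) K d(x)² V ≤ c (θ(x)/k) V`, where `V` is the `L_p` norm of the
  -- indicator of the window and cancels.
  refine lt_of_le_of_lt (iSup_le fun x => ENNReal.ofReal_le_ofReal ?_)
    (ENNReal.ofReal_lt_top (r := c / (k ^ 2 * K)))
  have hdx := averagingRadius_pos hq hq0 hpos x
  have hμx := hμ x
  have hθx := hθ x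
  set d := averagingRadius q x with hd
  set I := Icc (x - d / 2) (x + d / 2) with hI
  have hmem : ∀ ξ ∈ I, |ξ - x| ≤ d / 2 := fun ξ hξ => by
    rw [abs_le]; constructor <;> linarith [hξ.1, hξ.2]
  set f : ℝ → ℝ := I.indicator fun _ => 1 with hf
  have hvol : volume I = ENNReal.ofReal d := by
    rw [hI, Real.volume_Icc]; congr 1; ring
  set V : ℝ≥0∞ := volume I ^ (1 / p.toReal) with hV
  have hV0 : V ≠ 0 := by
    rw [hV, hvol]
    exact (ENNReal.rpow_pos (by simpa using hdx) ENNReal.ofReal_ne_top).ne'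
  have hVt : V ≠ ∞ := by
    rw [hV, hvol]
    exact ENNReal.rpow_ne_top_of_nonneg (by positivity) ENNReal.ofReal_ne_top
  have hfnorm : weightedNorm θ p f ≤ ENNReal.ofReal (θ x / k) * V := by
    have h1 : weightedNorm θ p f ≤ eLpNorm (I.indicator fun _ => θ x / k) p volume := by
      refine eLpNorm_mono_real fun ξ => ?_
      by_cases hξ : ξ ∈ I
      · simp only [hf, indicator_of_mem hξ, mul_one]
        rw [Real.norm_of_nonneg (hθ ξ).le]
        exact (hk x ξ (hmem ξ hξ)).2
      · simp [hf, hξ]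
    rwa [eLpNorm_indicator_const measurableSet_Icc hp0 hp_top,
      Real.enorm_of_nonneg (by positivity)] at h1
  have hfmem : MemWeightedLp θ p f := by
    have hfL : MemLp f p volume := memLp_indicator_const p measurableSet_Icc 1
      (Or.inr (by rw [hvol]; exact ENNReal.ofReal_ne_top))
    exact ⟨⟨hfL.1, fun K _ => hfL.restrict K⟩,
      hfnorm.trans_lt (ENNReal.mul_lt_top ENNReal.ofReal_lt_top hVt.lt_top)⟩
  obtain ⟨y, ⟨hysol, hymem⟩, -⟩ := hex f hfmem
  have hyeq := h.eq_greenOp_indicator hq hq0 hpos hp hp_top hμc hμ hdiv hysol hymem.2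
  have hynorm : ENNReal.ofReal (k * μ x * (K * d ^ 2)) * V ≤ weightedNorm μ p y := by
    have h1 : eLpNorm (I.indicator fun _ => k * μ x * (K * d ^ 2)) p volume ≤
        weightedNorm μ p y := by
      refine eLpNorm_mono fun ξ => ?_
      by_cases hξ : ξ ∈ I
      · have h2 := (hk x ξ (hmem ξ hξ)).1
        have h3 : K * d ^ 2 ≤ y ξ := by
          rw [hyeq]; exact h.le_greenOp_indicator hq hq0 hpos (hmem ξ hξ)
        have h4 : k * μ x * (K * d ^ 2) ≤ μ ξ * y ξ :=
          mul_le_mul h2 h3 (by positivity) (hμ ξ).le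
        rw [indicator_of_mem hξ, Real.norm_of_nonneg (by positivity)]
        exact h4.trans (le_abs_self _)
      · rw [indicator_of_notMem hξ, norm_zero]
        exact norm_nonneg _
    rwa [eLpNorm_indicator_const measurableSet_Icc hp0 hp_top,
      Real.enorm_of_nonneg (by positivity)] at h1
  have hfinal : ENNReal.ofReal (k * μ x * (K * d ^ 2)) * V ≤
      ENNReal.ofReal (c * (θ x / k)) * V := by
    refine hynorm.trans ((hc f y hfmem hysol hymem).trans ?_)
    rw [ENNReal.ofReal_mul hc0.le, mul_assoc]
    gcongr
  have h5 := (ENNReal.mul_le_mul_iff_left hV0 hVt).1 hfinal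
  rw [ENNReal.ofReal_le_ofReal_iff (by positivity)] at h5
  rw [le_div_iff₀ (by positivity)]
  calc μ x / θ x * d ^ 2 * (k ^ 2 * K) = k * μ x * (K * d ^ 2) * (k / θ x) := by ring
    _ ≤ c * (θ x / k) * (k / θ x) := by gcongr
    _ = c := by field_simp

end PrincipalPair

end SturmLiouville

theorem theorem4p7 (q μ θ : ℝ → ℝ)
    (hq_loc : MeasureTheory.LocallyIntegrable q MeasureTheory.volume)
    (hq_nonneg : ∀ᵐ x : ℝ, 0 ≤ q x)
    (hq_tails : SturmLiouville.PositiveTails q)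
    (hμ_cont : Continuous μ) (hμ_pos : ∀ x : ℝ, 0 < μ x)
    (hθ_cont : Continuous θ) (hθ_pos : ∀ x : ℝ, 0 < θ x)
    (hμ_div : SturmLiouville.DivergentTails μ)
    (hqH : SturmLiouville.ClassH q)
    (hagree : SturmLiouville.Agrees q μ θ)
    (p : ℝ≥0∞) (hp_one : 1 ≤ p) (hp_top : p ≠ ∞) :
    SturmLiouville.IsAdmissible q μ θ p ↔ SturmLiouville.weightSup q μ θ < ∞ := by
  obtain ⟨u, u', v, v', h⟩ := SturmLiouville.exists_principalPair hq_loc hq_nonneg hq_tails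
  exact ⟨h.weightSup_lt_top hq_loc hq_nonneg hq_tails hp_one hp_top hμ_cont hμ_pos hθ_pos
      hμ_div hagree,
    h.isAdmissible hq_loc hq_nonneg hq_tails hp_one hp_top hμ_cont hμ_pos hθ_cont hθ_pos
      hμ_div hagree⟩
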